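/- Let $\mathbb{F}_\epsilon$ be a finite field with $\hat q$ elements, let $K$ be a field containing $\mathbb{F}_\epsilon$ that is complete with respect to a non-trivial non-archimedean absolute value $|\cdot|$, and let $\zeta\in K$ with $0<|\zeta|<1$. Let $\overline K$ be the completion of an algebraic closure of $K$, with valuation ring $\mathcal{O}_{\overline K}$, and let $Q_\epsilon=\mathbb{F}_\epsilon((z))$. Let $$\mathcal{O}_{\overline K}[[z,z^{-1}\}=\Bigl\{\sum_{i\in\mathbb{Z}}b_iz^i:\ b_i\in\mathcal{O}_{\overline K},\ |b_i|\,|\zeta|^{ri}\to0\ (i\to-\infty)\text{ for all }r>0\Bigr\},$$ with the endomorphism $\hat\sigma(\sum_i b_iz^i)=\sum_i b_i^{\hat q}z^i$. It is mapped to $\overline K[[z-\zeta]]$ by the expansion $\sum_i b_iz^i=\sum_{j\ge0}\zeta^{-j}\bigl(\sum_{i}\binom ij b_i\zeta^i\bigr)(z-\zeta)^j$. Choose $\ell_i\in\overline K$ ($i\ge0$) with $\ell_0^{\hat q-1}=-\zeta$ and $\ell_i^{\hat q}+\zeta\ell_i=\ell_{i-1}$ for $i\ge1$, and set $\ell_+=\sum_{i\ge0}\ell_iz^i$,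 $\ell_-=\prod_{i\ge0}(1-\zeta^{\hat q^i}/z)$ and $\ell=\ell_+\ell_-\in\mathcal{O}_{\overline K}[[z,z^{-1}\}$. Then $\hat\sigma(\ell)=z\ell$, and $\ell$ is non-zero in $\overline K[[z-\zeta]]$, so that $\hat\sigma$ extends to $\mathcal{O}_{\overline K}[[z,z^{-1}\}[\ell^{-1}]$ and this ring is mapped to $\overline K((z-\zeta))$. 1. For every choice of the $\ell_i$ the following sequence of $Q_\epsilon$-vector spaces is exact: $$0\to Q_\epsilon\to\mathcal{O}_{\overline K}[[z,z^{-1}\}[\ell^{-1}]^{\hat\sigma=\mathrm{id}}\oplus\overline K[[z-\zeta]]\to\overline K((z-\zeta))\to0,\qquad a\mapsto(a,a),\quad (f,g)\mapsto f-g.$$ 2. For every $c\in\overline K$ there is an $f=\sum_{i\in\mathbb{Z}}b_iz^i\in\mathcal{O}_{\overline K}[[z,z^{-1}\}$ with $f=z^{-1}\hat\sigma(f)$ and $c=f(\zeta):=\sum_{i\in\mathbb{Z}}b_i\zeta^i$. -/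

import Mathlib

open Filter Topology

set_option linter.unusedSectionVars false

noncomputable section

namespace FundSeq

section Ring

variable (C : Type*) [NontriviallyNormedField C] [IsUltrametricDist C]

/-- The underlying additive group of `BRig C`. -/
def bRigAddSubgroup : AddSubgroup (ℤ → C) where
  carrier := {b | (∀ i, ‖b i‖ ≤ 1) ∧
    ∀ ρ : ℝ, 0 < ρ → ρ < 1 → Tendsto (fun i : ℤ => ‖b i‖ * ρ ^ i) atBot (𝓝 0)}
  zero_mem' := by simp
  add_mem' := by
    rintro a b ⟨ha, ha'⟩ ⟨hb, hb'⟩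
    refine ⟨fun i => (IsUltrametricDist.norm_add_le_max _ _).trans (max_le (ha i) (hb i)),
      fun ρ h0 h1 => ?_⟩
    refine squeeze_zero (fun i => by positivity) (fun i => ?_)
      (by simpa using (ha' ρ h0 h1).add (hb' ρ h0 h1))
    rw [← add_mul]
    exact mul_le_mul_of_nonneg_right (norm_add_le _ _) (by positivity)
  neg_mem' := by
    rintro a ⟨ha, ha'⟩
    exact ⟨fun i => by simpa using ha i, fun ρ h0 h1 => by simpa using ha' ρ h0 h1⟩

/-- For a nonarchimedean field `C` with valuation ring `O`, the ring `O[[z, z⁻¹}` of Laurent series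
`∑ b_i z ^ i`, `i ∈ ℤ`, with `b_i ∈ O` and `|b_i| ρ ^ i → 0` for `i → -∞`, for all `0 < ρ < 1`.
By `BRig.convergence_iff` one may let `ρ` run through the numbers `|ζ| ^ r`, `r > 0`, for any fixed
`ζ` with `0 < |ζ| < 1`. -/
def BRig : Type _ := bRigAddSubgroup C

instance : AddCommGroup (BRig C) := inferInstanceAs (AddCommGroup (bRigAddSubgroup C))

variable {C}

namespace BRig

/-- The coefficient of `z ^ i`. -/
def coeff (b : BRig C) (i : ℤ) : C := b.1 i

@[ext] lemma ext {a b : BRig C} (h : ∀ i, a.coeff i = b.coeff i) : a = b :=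
  Subtype.ext (funext h)

/-- Constructor from coefficients. -/
def mk (b : ℤ → C) (h : ∀ i, ‖b i‖ ≤ 1)
    (h' : ∀ ρ : ℝ, 0 < ρ → ρ < 1 → Tendsto (fun i : ℤ => ‖b i‖ * ρ ^ i) atBot (𝓝 0)) : BRig C :=
  ⟨b, h, h'⟩

@[simp] lemma coeff_mk (b : ℤ → C) (h h') (i : ℤ) : (mk b h h').coeff i = b i := rfl
@[simp] lemma coeff_add (a b : BRig C) (i : ℤ) : (a + b).coeff i = a.coeff i + b.coeff i := rfl
@[simp] lemma coeff_sub (a b : BRig C) (i : ℤ) : (a - b).coeff i = a.coeff i - b.coeff i := rfl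
@[simp] lemma coeff_zero (i : ℤ) : (0 : BRig C).coeff i = 0 := rfl

lemma norm_coeff_le (a : BRig C) (i : ℤ) : ‖a.coeff i‖ ≤ 1 := a.2.1 i

lemma tendsto_atBot (a : BRig C) {ρ : ℝ} (h0 : 0 < ρ) (h1 : ρ < 1) :
    Tendsto (fun i : ℤ => ‖a.coeff i‖ * ρ ^ i) atBot (𝓝 0) := a.2.2 ρ h0 h1

/-- The convergence condition in terms of `|ζ| ^ r`, `r > 0`. -/
lemma convergence_iff {ζ : C} (h0 : ζ ≠ 0) (h1 : ‖ζ‖ < 1) (b : ℤ → C) :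
    (∀ ρ : ℝ, 0 < ρ → ρ < 1 → Tendsto (fun i : ℤ => ‖b i‖ * ρ ^ i) atBot (𝓝 0)) ↔
    ∀ r : ℝ, 0 < r → Tendsto (fun i : ℤ => ‖b i‖ * ‖ζ‖ ^ (r * i)) atBot (𝓝 0) := by
  have hζ : 0 < ‖ζ‖ := norm_pos_iff.2 h0
  constructor
  · intro h r hr
    have := h (‖ζ‖ ^ r) (Real.rpow_pos_of_pos hζ r) (Real.rpow_lt_one hζ.le h1 hr)
    refine this.congr fun i => ?_
    rw [Real.rpow_mul hζ.le, Real.rpow_intCast]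
  · intro h ρ hρ0 hρ1
    have := h (Real.logb ‖ζ‖ ρ) (Real.logb_pos_of_base_lt_one hζ h1 hρ0 hρ1)
    refine this.congr fun i => ?_
    rw [Real.rpow_mul hζ.le, Real.rpow_logb hζ h1.ne hρ0, Real.rpow_intCast]

lemma tendsto_cofinite (a : BRig C) {ρ : ℝ} (h0 : 0 < ρ) (h1 : ρ < 1) :
    Tendsto (fun i : ℤ => ‖a.coeff i‖ * ρ ^ i) cofinite (𝓝 0) := by
  rw [Int.cofinite_eq, tendsto_sup]
  refine ⟨a.tendsto_atBot h0 h1, ?_⟩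
  have : Tendsto (fun i : ℤ => ρ ^ i) atTop (𝓝 0) := by
    have h2 : Tendsto (fun i : ℤ => ρ ^ (i.toNat)) atTop (𝓝 0) :=
      (tendsto_pow_atTop_nhds_zero_of_lt_one h0.le h1).comp
        (tendsto_atTop.2 fun n => (eventually_ge_atTop (n : ℤ)).mono fun i hi => by omega)
    refine h2.congr' ((eventually_ge_atTop (0 : ℤ)).mono fun i hi => ?_)
    rw [← zpow_natCast, Int.toNat_of_nonneg hi]
  refine squeeze_zero (fun i => by positivity) (fun i => ?_) this
  have := mul_le_mul_of_nonneg_right (a.norm_coeff_le i) (zpow_nonneg h0.le i)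
  simpa using this

variable [CompleteSpace C]

lemma summable_weight (a : BRig C) {w : C} (h0 : w ≠ 0) (h1 : ‖w‖ < 1) :
    Summable (fun i : ℤ => a.coeff i * w ^ i) := by
  apply NonarchimedeanAddGroup.summable_of_tendsto_cofinite_zero
  rw [tendsto_zero_iff_norm_tendsto_zero]
  simpa using a.tendsto_cofinite (norm_pos_iff.2 h0) h1

lemma summable_mul {α β : Type*} (f : α → C) (g : β → C) (hf : Summable f) (hg : Summable g) :
    Summable (fun p : α × β => f p.1 * g p.2) :=
  NonarchimedeanAddGroup.summable_of_tendsto_cofinite_zero <|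
    tendsto_mul_cofinite_nhds_zero hf.tendsto_cofinite_zero hg.tendsto_cofinite_zero

lemma tsum_mul_tsum' {α β : Type*} (f : α → C) (g : β → C) (hf : Summable f) (hg : Summable g) :
    (∑' a, f a) * (∑' b, g b) = ∑' p : α × β, f p.1 * g p.2 :=
  hf.tsum_mul_tsum hg (summable_mul f g hf hg)

lemma summable_prod (a b : BRig C) {w : C} (h0 : w ≠ 0) (h1 : ‖w‖ < 1) :
    Summable (fun p : ℤ × ℤ => (a.coeff p.1 * w ^ p.1) * (b.coeff p.2 * w ^ p.2)) :=
  summable_mul (fun i : ℤ => a.coeff i * w ^ i) (fun i : ℤ => b.coeff i * w ^ i)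
    (a.summable_weight h0 h1) (b.summable_weight h0 h1)

lemma summable_triple (a b c : BRig C) {w : C} (h0 : w ≠ 0) (h1 : ‖w‖ < 1) :
    Summable (fun p : (ℤ × ℤ) × ℤ => ((a.coeff p.1.1 * w ^ p.1.1) * (b.coeff p.1.2 * w ^ p.1.2))
      * (c.coeff p.2 * w ^ p.2)) :=
  summable_mul (fun p : ℤ × ℤ => (a.coeff p.1 * w ^ p.1) * (b.coeff p.2 * w ^ p.2))
    (fun i : ℤ => c.coeff i * w ^ i) (a.summable_prod b h0 h1) (c.summable_weight h0 h1)

lemma exists_weight : ∃ w : C, w ≠ 0 ∧ ‖w‖ < 1 := by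
  obtain ⟨w, hw, h⟩ := NormedField.exists_norm_lt_one C
  exact ⟨w, norm_pos_iff.1 hw, h⟩

lemma summable_conv (a b : BRig C) (n : ℤ) :
    Summable (fun i : ℤ => a.coeff i * b.coeff (n - i)) := by
  obtain ⟨w, h0, h1⟩ := exists_weight (C := C)
  have h := (a.summable_prod b h0 h1).comp_injective
    (i := fun i : ℤ => (i, n - i)) (fun i j h => (Prod.mk.inj h).1)
  refine (h.mul_right (w ^ (-n))).congr fun i => ?_
  have : w ^ i * w ^ (n - i) * w ^ (-n) = 1 := by
    rw [← zpow_add₀ h0, ← zpow_add₀ h0]; simp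
  simp only [Function.comp]
  linear_combination (a.coeff i * b.coeff (n - i)) * this

lemma summable_conv₂ (a b c : BRig C) (n : ℤ) :
    Summable (fun p : ℤ × ℤ => a.coeff p.2 * b.coeff (p.1 - p.2) * c.coeff (n - p.1)) := by
  obtain ⟨w, h0, h1⟩ := exists_weight (C := C)
  have h := (a.summable_triple b c h0 h1).comp_injective
    (i := fun p : ℤ × ℤ => ((p.2, p.1 - p.2), n - p.1)) (by
      rintro ⟨i, j⟩ ⟨k, l⟩ h
      simp only [Prod.mk.injEq] at h ⊢
      omega)
  refine (h.mul_right (w ^ (-n))).congr fun p => ?_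
  have : w ^ p.2 * w ^ (p.1 - p.2) * w ^ (n - p.1) * w ^ (-n) = 1 := by
    rw [← zpow_add₀ h0, ← zpow_add₀ h0, ← zpow_add₀ h0]; simp
  simp only [Function.comp]
  linear_combination (a.coeff p.2 * b.coeff (p.1 - p.2) * c.coeff (n - p.1)) * this

/-- The product of two Laurent series: `(a b)_n = ∑ i, a_i b_{n - i}`. -/
def mul (a b : BRig C) : BRig C :=
  mk (fun n => ∑' i : ℤ, a.coeff i * b.coeff (n - i))
    (fun n => IsUltrametricDist.norm_tsum_le_of_forall_le_of_nonneg zero_le_one fun i => by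
      rw [norm_mul]
      exact mul_le_one₀ (a.norm_coeff_le i) (norm_nonneg _) (b.norm_coeff_le _))
    (fun ρ h0 h1 => by
      refine Tendsto.mono_left ?_ (Int.cofinite_eq ▸ le_sup_left : atBot ≤ cofinite (α := ℤ))
      have hA := a.tendsto_cofinite h0 h1
      have hB := b.tendsto_cofinite h0 h1
      have key : Tendsto (fun p : ℤ × ℤ => (‖a.coeff p.1‖ * ρ ^ p.1) * (‖b.coeff p.2‖ * ρ ^ p.2))
          cofinite (𝓝 0) := tendsto_mul_cofinite_nhds_zero hA hB
      rw [Metric.tendsto_nhds] at key ⊢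
      intro ε hε
      have hfin := key (ε / 2) (half_pos hε)
      rw [eventually_cofinite] at hfin ⊢
      refine (hfin.image (fun p => p.1 + p.2)).subset fun n hn => ?_
      by_contra hcon
      apply hn
      have hle : ∀ i : ℤ, ‖a.coeff i * b.coeff (n - i)‖ ≤ ε / 2 * ρ ^ (-n) := by
        intro i
        by_contra hi
        refine hcon ⟨(i, n - i), fun hlt => hi ?_, by simp⟩
        rw [Real.dist_eq, sub_zero] at hlt
        have h3 := (le_abs_self _).trans hlt.le
        have h4 := mul_le_mul_of_nonneg_right h3 (zpow_nonneg h0.le (-n))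
        refine le_trans (le_of_eq ?_) h4
        have : ρ ^ i * ρ ^ (n - i) * ρ ^ (-n) = 1 := by
          rw [← zpow_add₀ h0.ne', ← zpow_add₀ h0.ne']; simp
        rw [norm_mul]
        linear_combination -(‖a.coeff i‖ * ‖b.coeff (n - i)‖) * this
      have h5 := IsUltrametricDist.norm_tsum_le_of_forall_le_of_nonneg (by positivity) hle
      rw [Real.dist_eq, sub_zero, abs_of_nonneg (by positivity)]
      have h6 := mul_le_mul_of_nonneg_right h5 (zpow_nonneg h0.le n)
      refine lt_of_le_of_lt h6 ?_
      rw [mul_assoc, ← zpow_add₀ h0.ne']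
      simpa using hε)

/-- The monomial `z ^ n`. -/
def zpow (n : ℤ) : BRig C :=
  mk (fun i => if i = n then 1 else 0) (fun i => by split_ifs <;> simp) fun ρ h0 h1 => by
    refine tendsto_const_nhds.congr' ((eventually_lt_atBot n).mono fun i hi => ?_)
    simp [hi.ne]

instance : Mul (BRig C) := ⟨mul⟩
instance : One (BRig C) := ⟨zpow 0⟩

lemma coeff_mul (a b : BRig C) (n : ℤ) :
    (a * b).coeff n = ∑' i : ℤ, a.coeff i * b.coeff (n - i) := rfl

lemma coeff_zpow (n i : ℤ) : (zpow n : BRig C).coeff i = if i = n then 1 else 0 := rfl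

lemma coeff_one (i : ℤ) : (1 : BRig C).coeff i = if i = 0 then 1 else 0 := rfl

protected lemma mul_comm (a b : BRig C) : a * b = b * a := by
  ext n
  rw [coeff_mul, coeff_mul, ← (Equiv.subLeft n).tsum_eq]
  exact tsum_congr fun i => by simp [mul_comm]

lemma coeff_zpow_mul (n : ℤ) (a : BRig C) (i : ℤ) : (zpow n * a).coeff i = a.coeff (i - n) := by
  rw [coeff_mul, tsum_eq_single n]
  · simp [coeff_zpow]
  · intro j hj; simp [coeff_zpow, hj]

protected lemma mul_add (a b c : BRig C) : a * (b + c) = a * b + a * c := by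
  ext n
  rw [coeff_add, coeff_mul, coeff_mul, coeff_mul,
    ← (a.summable_conv b n).tsum_add (a.summable_conv c n)]
  exact tsum_congr fun i => by simp [mul_add]

protected lemma mul_assoc (a b c : BRig C) : a * b * c = a * (b * c) := by
  ext n
  have h := (a.summable_conv₂ b c n).tsum_comm
    (f := fun k i : ℤ => a.coeff i * b.coeff (k - i) * c.coeff (n - k))
  rw [coeff_mul, coeff_mul]
  calc ∑' k, (a * b).coeff k * c.coeff (n - k)
      = ∑' (k : ℤ) (i : ℤ), a.coeff i * b.coeff (k - i) * c.coeff (n - k) :=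
        tsum_congr fun k => by rw [coeff_mul, ← tsum_mul_right]
    _ = ∑' (i : ℤ) (k : ℤ), a.coeff i * b.coeff (k - i) * c.coeff (n - k) := h.symm
    _ = ∑' i, a.coeff i * (b * c).coeff (n - i) := tsum_congr fun i => by
        rw [coeff_mul, ← tsum_mul_left, ← (Equiv.addRight i).tsum_eq]
        exact tsum_congr fun k => by
          simp only [Equiv.coe_addRight, add_sub_cancel_right, mul_assoc]
          rw [show n - (k + i) = n - i - k by ring]

protected lemma one_mul (a : BRig C) : 1 * a = a := by
  ext i
  exact (coeff_zpow_mul 0 a i).trans (by rw [sub_zero])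

instance : CommRing (BRig C) where
  __ := (inferInstance : AddCommGroup (BRig C))
  __ := (inferInstance : Mul (BRig C))
  __ := (inferInstance : One (BRig C))
  mul_assoc := BRig.mul_assoc
  mul_comm := BRig.mul_comm
  one_mul := BRig.one_mul
  mul_one a := by rw [BRig.mul_comm, BRig.one_mul]
  left_distrib := BRig.mul_add
  right_distrib a b c := by
    rw [BRig.mul_comm, BRig.mul_add, BRig.mul_comm c, BRig.mul_comm c]
  zero_mul a := by ext n; simp [coeff_mul]
  mul_zero a := by ext n; simp [coeff_mul]

lemma zpow_mul_zpow (m n : ℤ) : (zpow m * zpow n : BRig C) = zpow (m + n) := by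
  ext i
  rw [coeff_zpow_mul, coeff_zpow, coeff_zpow]
  simp only [sub_eq_iff_eq_add, add_comm]


end BRig
end Ring

section Frobenius

variable (F : Type*) [Field F] [Finite F]
variable {C : Type*} [NontriviallyNormedField C] [IsUltrametricDist C] [CompleteSpace C]
variable [Algebra F C]

lemma one_lt_card : 1 < Nat.card F := Finite.one_lt_card

variable (C) in
/-- The `q`-Frobenius of the `F`-algebra `C`, where `q` is the cardinality of `F`. -/
def frob : C →+* C where
  toFun x := x ^ Nat.card F
  map_zero' := zero_pow (one_lt_card F).ne_bot
  map_one' := one_pow _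
  map_mul' x y := mul_pow x y _
  map_add' x y := by
    have := Fintype.ofFinite F
    have h := map_add (FiniteField.frobeniusAlgHom F C) x y
    simpa only [FiniteField.coe_frobeniusAlgHom, Nat.card_eq_fintype_card] using h

lemma frob_apply (x : C) : frob F C x = x ^ Nat.card F := rfl

lemma continuous_frob : Continuous (frob F C) := continuous_pow _

namespace BRig

/-- The endomorphism `∑ b_i z ^ i ↦ ∑ b_i ^ q z ^ i`. -/
def sigma : BRig C →+* BRig C where
  toFun b := mk (fun i => b.coeff i ^ Nat.card F)
    (fun i => by rw [norm_pow]; exact pow_le_one₀ (norm_nonneg _) (b.norm_coeff_le i))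
    (fun ρ h0 h1 => by
      refine squeeze_zero (fun i => by positivity) (fun i => ?_) (b.tendsto_atBot h0 h1)
      refine mul_le_mul_of_nonneg_right ?_ (by positivity)
      rw [norm_pow]
      exact pow_le_of_le_one (norm_nonneg _) (b.norm_coeff_le i) (one_lt_card F).ne_bot)
  map_zero' := by ext i; exact map_zero (frob F C)
  map_one' := by
    ext i
    rw [coeff_mk, coeff_one]
    split_ifs
    · exact one_pow _
    · exact map_zero (frob F C)
  map_add' a b := by ext i; exact map_add (frob F C) _ _
  map_mul' a b := by
    ext n
    rw [coeff_mul, coeff_mk, coeff_mul]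
    refine ((a.summable_conv b n).map_tsum (frob F C) (continuous_frob F)).trans ?_
    exact tsum_congr fun i => map_mul (frob F C) _ _

lemma coeff_sigma (b : BRig C) (i : ℤ) : (sigma F b).coeff i = b.coeff i ^ Nat.card F := rfl

lemma sigma_zpow (n : ℤ) : sigma F (zpow n : BRig C) = zpow n := by
  ext i
  rw [coeff_sigma, coeff_zpow]
  split_ifs
  · exact one_pow _
  · exact map_zero (frob F C)

lemma norm_algebraMap_le (x : F) : ‖algebraMap F C x‖ ≤ 1 := by
  by_contra! h
  have := Fintype.ofFinite F
  have h2 : ‖algebraMap F C x‖ ^ Nat.card F = ‖algebraMap F C x‖ := by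
    rw [← norm_pow, ← map_pow, Nat.card_eq_fintype_card, FiniteField.pow_card]
  have h3 := pow_lt_pow_right₀ h (one_lt_card F)
  rw [h2, pow_one] at h3
  exact lt_irrefl _ h3

variable (C) in
/-- The embedding of `F((z))`. -/
def ofLaurent : LaurentSeries F →+* BRig C where
  toFun a := mk (fun i => algebraMap F C (HahnSeries.coeff a i))
    (fun i => norm_algebraMap_le F _)
    (fun ρ h0 h1 => by
      refine tendsto_const_nhds.congr' ((eventually_lt_atBot a.order).mono fun i hi => ?_)
      simp [HahnSeries.coeff_eq_zero_of_lt_order hi])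
  map_zero' := by ext i; simp
  map_one' := by
    ext i
    rw [coeff_mk, coeff_one, HahnSeries.coeff_one]
    split_ifs <;> simp
  map_add' a b := by ext i; simp
  map_mul' a b := by
    ext n
    rw [coeff_mul, coeff_mk, HahnSeries.coeff_mul, map_sum]
    simp only [coeff_mk]
    rw [tsum_eq_sum (s := (Finset.antidiagonal a.isPWO_support b.isPWO_support n).image Prod.fst)]
    · rw [Finset.sum_image]
      · refine Finset.sum_congr rfl fun p hp => ?_
        rw [Finset.mem_antidiagonal] at hp
        rw [map_mul, ← hp.2.2, add_sub_cancel_left]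
      · rintro ⟨i, j⟩ hp ⟨k, l⟩ hq h
        simp only [Finset.mem_coe, Finset.mem_antidiagonal] at hp hq h
        simp only [Prod.mk.injEq]
        omega
    · intro i hi
      by_contra hne
      apply hi
      rw [← map_mul] at hne
      have h2 : a.coeff i * b.coeff (n - i) ≠ 0 := fun h => hne (by rw [h, map_zero])
      rw [Finset.mem_image]
      refine ⟨(i, n - i), ?_, rfl⟩
      rw [Finset.mem_antidiagonal]
      exact ⟨left_ne_zero_of_mul h2, right_ne_zero_of_mul h2, by simp⟩

lemma coeff_ofLaurent (a : LaurentSeries F) (i : ℤ) :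
    (ofLaurent F C a).coeff i = algebraMap F C (HahnSeries.coeff a i) := rfl

lemma sigma_ofLaurent (a : LaurentSeries F) : sigma F (ofLaurent F C a) = ofLaurent F C a := by
  have := Fintype.ofFinite F
  ext i
  rw [coeff_sigma, coeff_ofLaurent, ← map_pow, Nat.card_eq_fintype_card, FiniteField.pow_card]

end BRig
end Frobenius

section Taylor

variable {C : Type*} [NontriviallyNormedField C] [IsUltrametricDist C] [CompleteSpace C]
variable (ζ : C)

namespace BRig

/-- The `i`-th term in the series for the `j`-th Taylor coefficient. -/
def taylorTerm (b : BRig C) (j : ℕ) (i : ℤ) : C :=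
  ((Ring.choose i j : ℤ) : C) * b.coeff i * ζ ^ i

/-- The `j`-th coefficient `ζ ^ (-j) * ∑ i, (i choose j) b_i ζ ^ i` of the expansion of
`∑ b_i z ^ i` in powers of `z - ζ`. -/
def taylorCoeff (b : BRig C) (j : ℕ) : C :=
  (ζ ^ j)⁻¹ * ∑' i : ℤ, taylorTerm ζ b j i

variable {ζ}

lemma summable_taylor (h0 : ζ ≠ 0) (h1 : ‖ζ‖ < 1) (b : BRig C) (j : ℕ) :
    Summable (taylorTerm ζ b j) := by
  apply NonarchimedeanAddGroup.summable_of_tendsto_cofinite_zero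
  rw [tendsto_zero_iff_norm_tendsto_zero]
  refine squeeze_zero (fun i => norm_nonneg _) (fun i => ?_)
    (b.tendsto_cofinite (norm_pos_iff.2 h0) h1)
  rw [taylorTerm, mul_assoc, norm_mul, norm_mul, norm_zpow]
  exact mul_le_of_le_one_left (by positivity) (IsUltrametricDist.norm_intCast_le_one C _)

lemma summable_taylor₂ (h0 : ζ ≠ 0) (h1 : ‖ζ‖ < 1) (a b : BRig C) (j k : ℕ) :
    Summable (fun x : ℤ × ℤ => taylorTerm ζ a j x.1 * taylorTerm ζ b k x.2) :=
  summable_mul (taylorTerm ζ a j) (taylorTerm ζ b k)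
    (a.summable_taylor h0 h1 j) (b.summable_taylor h0 h1 k)

lemma taylorCoeff_mul_taylorCoeff (h0 : ζ ≠ 0) (h1 : ‖ζ‖ < 1) (a b : BRig C) (j k : ℕ) :
    taylorCoeff ζ a j * taylorCoeff ζ b k =
      (ζ ^ (j + k))⁻¹ * ∑' x : ℤ × ℤ, taylorTerm ζ a j x.1 * taylorTerm ζ b k x.2 := by
  rw [← tsum_mul_tsum' _ _ (a.summable_taylor h0 h1 j) (b.summable_taylor h0 h1 k),
    taylorCoeff, taylorCoeff, pow_add, mul_inv]
  ring

lemma sum_taylorTerm (h0 : ζ ≠ 0) (a b : BRig C) (n : ℕ) (i m : ℤ) :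
    ∑ p ∈ Finset.HasAntidiagonal.antidiagonal n, taylorTerm ζ a p.1 i * taylorTerm ζ b p.2 m =
      ((Ring.choose (i + m) n : ℤ) : C) * (a.coeff i * b.coeff m) * ζ ^ (i + m) := by
  rw [Ring.add_choose_eq n (Commute.all i m), Int.cast_sum, Finset.sum_mul, Finset.sum_mul]
  refine Finset.sum_congr rfl fun p _ => ?_
  rw [taylorTerm, taylorTerm, Int.cast_mul, zpow_add₀ h0]
  ring

lemma taylorCoeff_mul (h0 : ζ ≠ 0) (h1 : ‖ζ‖ < 1) (a b : BRig C) (n : ℕ) :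
    taylorCoeff ζ (a * b) n =
      ∑ p ∈ Finset.HasAntidiagonal.antidiagonal n, taylorCoeff ζ a p.1 * taylorCoeff ζ b p.2 := by
  have e1 : ∀ p ∈ Finset.HasAntidiagonal.antidiagonal n, taylorCoeff ζ a p.1 * taylorCoeff ζ b p.2 =
      (ζ ^ n)⁻¹ * ∑' x : ℤ × ℤ, taylorTerm ζ a p.1 x.1 * taylorTerm ζ b p.2 x.2 := by
    intro p hp
    rw [Finset.HasAntidiagonal.mem_antidiagonal] at hp
    rw [taylorCoeff_mul_taylorCoeff h0 h1, hp]
  have hs := fun p (_ : p ∈ Finset.HasAntidiagonal.antidiagonal n) =>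
    summable_taylor₂ h0 h1 a b p.1 p.2
  rw [Finset.sum_congr rfl e1, ← Finset.mul_sum, ← Summable.tsum_finsetSum hs, taylorCoeff]
  congr 1
  have hFs := summable_sum hs
  simp only [sum_taylorTerm h0] at hFs ⊢
  let e : ℤ × ℤ ≃ ℤ × ℤ :=
    ⟨fun x => (x.2, x.1 - x.2), fun y => (y.1 + y.2, y.1), fun x => by simp, fun y => by simp⟩
  rw [← e.tsum_eq]
  refine Eq.trans ?_ (e.summable_iff.2 hFs).tsum_prod.symm
  refine tsum_congr fun s => ?_
  rw [taylorTerm, coeff_mul, ← tsum_mul_left, ← tsum_mul_right]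
  refine tsum_congr fun i => ?_
  simp only [Function.comp, e, Equiv.coe_fn_mk, add_sub_cancel]

/-- The expansion of a Laurent series at `z = ζ`; the variable `X` stands for `z - ζ`. -/
def taylor (h0 : ζ ≠ 0) (h1 : ‖ζ‖ < 1) : BRig C →+* PowerSeries C where
  toFun b := PowerSeries.mk (taylorCoeff ζ b)
  map_zero' := by ext n; simp [taylorCoeff, taylorTerm]
  map_one' := by
    ext n
    rw [PowerSeries.coeff_mk, PowerSeries.coeff_one, taylorCoeff, tsum_eq_single 0]
    · rw [taylorTerm, coeff_one, Ring.choose_zero_ite, if_pos rfl]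
      split_ifs with h
      · simp [h]
      · simp
    · intro i hi
      simp [taylorTerm, coeff_one, hi]
  map_add' a b := by
    ext n
    rw [map_add, PowerSeries.coeff_mk, PowerSeries.coeff_mk, PowerSeries.coeff_mk, taylorCoeff,
      taylorCoeff, taylorCoeff, ← mul_add, ← (a.summable_taylor h0 h1 n).tsum_add
      (b.summable_taylor h0 h1 n)]
    congr 1
    exact tsum_congr fun i => by rw [taylorTerm, taylorTerm, taylorTerm, coeff_add]; ring
  map_mul' a b := by
    ext n
    rw [PowerSeries.coeff_mul]
    simp only [PowerSeries.coeff_mk]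
    exact taylorCoeff_mul h0 h1 a b n

lemma coeff_taylor (h0 : ζ ≠ 0) (h1 : ‖ζ‖ < 1) (b : BRig C) (j : ℕ) :
    PowerSeries.coeff j (taylor h0 h1 b) = taylorCoeff ζ b j :=
  PowerSeries.coeff_mk j (taylorCoeff ζ b)

end BRig
end Taylor

section Period

variable {F : Type*} [Field F] [Finite F]
variable {C : Type*} [NontriviallyNormedField C] [IsUltrametricDist C] [CompleteSpace C]
variable [Algebra F C]

namespace BRig

/-- The constant series `c`. -/
def const (c : C) (hc : ‖c‖ ≤ 1) : BRig C :=
  mk (fun i => if i = 0 then c else 0) (fun i => by split_ifs <;> simp [hc]) fun ρ h0 h1 => by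
    refine tendsto_const_nhds.congr' ((eventually_lt_atBot 0).mono fun i hi => ?_)
    simp [hi.ne]

lemma coeff_const (c : C) (hc : ‖c‖ ≤ 1) (i : ℤ) :
    (const c hc).coeff i = if i = 0 then c else 0 := rfl

lemma coeff_const_mul (c : C) (hc : ‖c‖ ≤ 1) (a : BRig C) (i : ℤ) :
    (const c hc * a).coeff i = c * a.coeff i := by
  rw [coeff_mul, tsum_eq_single 0]
  · simp [coeff_const]
  · intro j hj; simp [coeff_const, hj]

lemma norm_pow_le_one {ζ : C} (h1 : ‖ζ‖ < 1) (n : ℕ) : ‖ζ ^ n‖ ≤ 1 := by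
  rw [norm_pow]; exact pow_le_one₀ (norm_nonneg _) h1.le

variable (F) in
/-- The partial product `∏ i < N, (1 - ζ ^ (q ^ i) / z)`. -/
def lminusPartial {ζ : C} (h1 : ‖ζ‖ < 1) (N : ℕ) : BRig C :=
  ∏ i ∈ Finset.range N,
    (1 - const (ζ ^ Nat.card F ^ i) (norm_pow_le_one h1 _) * zpow (-1))

lemma coeff_one_sub_mul (c : C) (hc : ‖c‖ ≤ 1) (a : BRig C) (i : ℤ) :
    ((1 - const c hc * zpow (-1)) * a).coeff i = a.coeff i - c * a.coeff (i + 1) := by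
  rw [sub_mul, one_mul, coeff_sub, mul_assoc, coeff_const_mul, coeff_zpow_mul, sub_neg_eq_add]

lemma sigma_one_sub {ζ : C} (h1 : ‖ζ‖ < 1) (n : ℕ) :
    sigma F (1 - const (ζ ^ Nat.card F ^ n) (norm_pow_le_one h1 _) * zpow (-1)) =
      1 - const (ζ ^ Nat.card F ^ (n + 1)) (norm_pow_le_one h1 _) * zpow (-1) := by
  rw [map_sub, map_one, map_mul, sigma_zpow]
  congr 2
  ext i
  rw [coeff_sigma, coeff_const, coeff_const]
  split_ifs
  · rw [← pow_mul, pow_succ]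
  · exact zero_pow (one_lt_card F).ne_bot

section
variable {ζ : C} (h1 : ‖ζ‖ < 1)

lemma lminusPartial_succ (N : ℕ) (i : ℤ) : (lminusPartial F h1 (N + 1)).coeff i =
    (lminusPartial F h1 N).coeff i - ζ ^ Nat.card F ^ N * (lminusPartial F h1 N).coeff (i + 1) := by
  rw [lminusPartial, Finset.prod_range_succ, mul_comm, coeff_one_sub_mul]
  rfl

lemma lminusPartial_succ' (N : ℕ) (i : ℤ) : (lminusPartial F h1 (N + 1)).coeff i =
    (lminusPartial F h1 N).coeff i ^ Nat.card F -
      ζ * (lminusPartial F h1 N).coeff (i + 1) ^ Nat.card F := by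
  rw [lminusPartial, Finset.prod_range_succ', mul_comm, coeff_one_sub_mul, pow_zero, pow_one,
    ← Finset.prod_congr rfl fun n _ => sigma_one_sub (F := F) h1 n, ← map_prod]
  rfl

lemma lminusPartial_pos (N : ℕ) (i : ℤ) (hi : 0 < i) : (lminusPartial F h1 N).coeff i = 0 := by
  induction N generalizing i with
  | zero => simp [lminusPartial, coeff_one, hi.ne']
  | succ N ih => rw [lminusPartial_succ, ih i hi, ih (i + 1) (by omega)]; simp

lemma lminusPartial_zero (N : ℕ) : (lminusPartial F h1 N).coeff 0 = 1 := by
  induction N with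
  | zero => simp [lminusPartial, coeff_one]
  | succ N ih => rw [lminusPartial_succ, ih, lminusPartial_pos _ _ _ (by omega)]; simp

lemma tendsto_pow_card (h1 : ‖ζ‖ < 1) : Tendsto (fun N => ‖ζ‖ ^ Nat.card F ^ N) atTop (𝓝 0) :=
  (tendsto_pow_atTop_nhds_zero_of_lt_one (norm_nonneg ζ) h1).comp
    (tendsto_pow_atTop_atTop_of_one_lt (one_lt_card F))

lemma exists_lminus_lim (i : ℤ) :
    ∃ x, Tendsto (fun N => (lminusPartial F h1 N).coeff i) atTop (𝓝 x) := by
  apply cauchySeq_tendsto_of_complete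
  apply NonarchimedeanAddGroup.cauchySeq_of_tendsto_sub_nhds_zero
  rw [tendsto_zero_iff_norm_tendsto_zero]
  refine squeeze_zero (fun i => norm_nonneg _) (fun N => ?_) (tendsto_pow_card (F := F) h1)
  rw [lminusPartial_succ, sub_sub_cancel_left, norm_neg, norm_mul, norm_pow]
  exact mul_le_of_le_one_right (by positivity) (norm_coeff_le _ _)

/-- The exponents `0, 1, 1 + q, 1 + q + q ^ 2, …`. -/
def geomExp (q : ℕ) : ℕ → ℕ
  | 0 => 0
  | n + 1 => 1 + q * geomExp q n

lemma le_geomExp {q : ℕ} (hq : 1 < q) (n : ℕ) : n ≤ geomExp q n := by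
  induction n with
  | zero => simp
  | succ n ih => rw [geomExp]; nlinarith

lemma sq_le_geomExp {q : ℕ} (hq : 1 < q) (n : ℕ) : n * (n + 1) ≤ 2 * geomExp q n := by
  induction n with
  | zero => simp
  | succ n ih => have := le_geomExp hq n; rw [geomExp]; nlinarith

lemma norm_lminusPartial_le (N n : ℕ) :
    ‖(lminusPartial F h1 N).coeff (-n)‖ ≤ ‖ζ‖ ^ geomExp (Nat.card F) n := by
  induction N generalizing n with
  | zero =>
    rcases n with _ | n
    · simpa [geomExp] using norm_coeff_le _ _
    · rw [lminusPartial, Finset.prod_range_zero, coeff_one, if_neg (by push_cast; omega), norm_zero]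
      positivity
  | succ N ih =>
    rcases n with _ | n
    · simpa [geomExp] using norm_coeff_le _ _
    · rw [lminusPartial_succ', sub_eq_add_neg]
      refine (IsUltrametricDist.norm_add_le_max _ _).trans (max_le ?_ ?_)
      · rw [norm_pow]
        exact (pow_le_of_le_one (norm_nonneg _) (norm_coeff_le _ _) (one_lt_card F).ne_bot).trans
          (ih (n + 1))
      · rw [norm_neg, norm_mul, norm_pow, geomExp, pow_add, pow_one, mul_comm (Nat.card F), pow_mul]
        refine mul_le_mul_of_nonneg_left (pow_le_pow_left₀ (norm_nonneg _) ?_ _) (norm_nonneg _)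
        rw [show -((n + 1 : ℕ) : ℤ) + 1 = -(n : ℤ) by push_cast; ring]
        exact ih n

variable (F) in
/-- The coefficients of the infinite product `∏ i, (1 - ζ ^ (q ^ i) / z)`. -/
def lminusCoeff (i : ℤ) : C := limUnder atTop fun N => (lminusPartial F h1 N).coeff i

lemma tendsto_lminusCoeff (i : ℤ) :
    Tendsto (fun N => (lminusPartial F h1 N).coeff i) atTop (𝓝 (lminusCoeff F h1 i)) :=
  tendsto_nhds_limUnder (exists_lminus_lim h1 i)

lemma norm_lminusCoeff_le (n : ℕ) :
    ‖lminusCoeff F h1 (-n)‖ ≤ ‖ζ‖ ^ geomExp (Nat.card F) n :=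
  le_of_tendsto (tendsto_lminusCoeff h1 _).norm
    (Eventually.of_forall fun N => norm_lminusPartial_le h1 N n)

variable (F) in
/-- The infinite product `ℓ₋ = ∏ i, (1 - ζ ^ (q ^ i) / z)`, as a coefficientwise limit. -/
def lminus : BRig C :=
  mk (lminusCoeff F h1)
    (fun i => le_of_tendsto (tendsto_lminusCoeff h1 i).norm
      (Eventually.of_forall fun N => norm_coeff_le _ _))
    (fun ρ h0 hρ => by
      obtain ⟨m, hm⟩ := exists_pow_lt_of_lt_one h0 h1
      have hr : ‖ζ‖ ^ m / ρ < 1 := (div_lt_one h0).2 hm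
      have hlim : Tendsto (fun i : ℤ => (‖ζ‖ ^ m / ρ) ^ (-i).toNat) atBot (𝓝 0) :=
        (tendsto_pow_atTop_nhds_zero_of_lt_one (by positivity) hr).comp
          (tendsto_atTop.2 fun n =>
            (eventually_le_atBot (-(n : ℤ))).mono fun i hi => by omega)
      refine squeeze_zero' (Eventually.of_forall fun i => by positivity) ?_ hlim
      filter_upwards [eventually_le_atBot (-(2 * m : ℤ))] with i hi
      obtain ⟨n, rfl⟩ : ∃ n : ℕ, i = -n := ⟨(-i).toNat, by omega⟩
      have hn : 2 * m ≤ n := by omega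
      rw [neg_neg, Int.toNat_natCast, div_pow, zpow_neg, zpow_natCast, ← div_eq_mul_inv, ← pow_mul]
      refine div_le_div_of_nonneg_right ?_ (by positivity)
      refine (norm_lminusCoeff_le h1 n).trans (pow_le_pow_of_le_one (norm_nonneg _) h1.le ?_)
      have := sq_le_geomExp (one_lt_card F) n
      nlinarith)

lemma tendsto_lminus (i : ℤ) :
    Tendsto (fun N => (lminusPartial F h1 N).coeff i) atTop (𝓝 ((lminus F h1).coeff i)) :=
  tendsto_lminusCoeff h1 i

lemma lminus_eq : lminus F h1 = (1 - const ζ h1.le * zpow (-1)) * sigma F (lminus F h1) := by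
  ext i
  rw [coeff_one_sub_mul, coeff_sigma, coeff_sigma]
  refine tendsto_nhds_unique ((tendsto_add_atTop_iff_nat 1).2 (tendsto_lminus h1 i)) ?_
  simp only [lminusPartial_succ']
  exact ((tendsto_lminus h1 i).pow _).sub (((tendsto_lminus h1 (i + 1)).pow _).const_mul ζ)

lemma lminus_zero : (lminus F h1).coeff 0 = 1 :=
  tendsto_nhds_unique (tendsto_lminus h1 0) (by simp [lminusPartial_zero])

lemma lminus_pos (i : ℤ) (hi : 0 < i) : (lminus F h1).coeff i = 0 :=
  tendsto_nhds_unique (tendsto_lminus h1 i) (by simp [lminusPartial_pos h1 _ i hi])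

end

end BRig

variable (F) in
/-- A system of solutions of `ℓ_0 ^ (q - 1) = -ζ` and `ℓ_i ^ q + ζ ℓ_i = ℓ_{i-1}` for `i ≥ 1`. -/
structure DivisionTower {L : Type*} [Field L] (ζ : L) where
  seq : ℕ → L
  seq_zero : seq 0 ^ (Nat.card F - 1) = -ζ
  seq_succ : ∀ i, seq (i + 1) ^ Nat.card F + ζ * seq (i + 1) = seq i

variable (F) in
/-- Such systems exist over an algebraically closed field. -/
theorem DivisionTower.nonempty {L : Type*} [Field L] [IsAlgClosed L] (ζ : L) :
    Nonempty (DivisionTower F ζ) := by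
  have h : ∀ y : L, ∃ x : L, x ^ Nat.card F + ζ * x = y := by
    intro y
    have hq := one_lt_card F
    have hd : (Polynomial.C ζ * Polynomial.X - Polynomial.C y : Polynomial L).degree <
        (Nat.card F : WithBot ℕ) := by
      refine lt_of_le_of_lt (b := (1 : WithBot ℕ)) ?_ (by exact_mod_cast hq)
      compute_degree
    obtain ⟨x, hx⟩ := IsAlgClosed.exists_root
      (Polynomial.X ^ Nat.card F + (Polynomial.C ζ * Polynomial.X - Polynomial.C y)) (by
        rw [Polynomial.degree_add_eq_left_of_degree_lt (by rwa [Polynomial.degree_X_pow]),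
          Polynomial.degree_X_pow]
        exact_mod_cast (by omega : Nat.card F ≠ 0))
    refine ⟨x, ?_⟩
    simp only [Polynomial.IsRoot, Polynomial.eval_add, Polynomial.eval_pow, Polynomial.eval_X,
      Polynomial.eval_sub, Polynomial.eval_mul, Polynomial.eval_C] at hx
    linear_combination hx
  choose f hf using h
  obtain ⟨x, hx⟩ := IsAlgClosed.exists_pow_nat_eq (-ζ)
    (show 0 < Nat.card F - 1 by have := one_lt_card F; omega)
  exact ⟨⟨fun n => Nat.rec x (fun _ y => f y) n, hx, fun i => hf _⟩⟩

/-- The image of a system of solutions in an extension field. -/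
def DivisionTower.map {L M : Type*} [Field L] [Field M] (f : L →+* M) {ζ : L}
    (l : DivisionTower F ζ) : DivisionTower F (f ζ) where
  seq i := f (l.seq i)
  seq_zero := by rw [← map_pow, l.seq_zero, map_neg]
  seq_succ i := by rw [← map_pow, ← map_mul, ← map_add, l.seq_succ]

namespace DivisionTower

open BRig

variable {ζ : C} (l : DivisionTower F ζ)

lemma norm_lt (h1 : ‖ζ‖ < 1) (i : ℕ) : ‖l.seq i‖ < 1 := by
  induction i with
  | zero =>
    by_contra! h
    have := one_le_pow₀ h (n := Nat.card F - 1)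
    rw [← norm_pow, l.seq_zero, norm_neg] at this
    exact absurd h1 (not_lt.2 this)
  | succ i ih =>
    by_contra! h
    have h2 : ‖l.seq (i + 1)‖ ≤ ‖l.seq (i + 1) ^ Nat.card F‖ := by
      rw [norm_pow]; exact le_self_pow₀ h (one_lt_card F).ne_bot
    rw [eq_sub_of_add_eq (l.seq_succ i), sub_eq_add_neg] at h2
    have h3 := h2.trans (IsUltrametricDist.norm_add_le_max _ _)
    rw [norm_neg, norm_mul, le_max_iff] at h3
    rcases h3 with h3 | h3
    · linarith
    · nlinarith

/-- The power series `ℓ₊ = ∑ i ≥ 0, ℓ_i z ^ i`. -/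
def lplus (h1 : ‖ζ‖ < 1) : BRig C :=
  BRig.mk (fun i => if 0 ≤ i then l.seq i.toNat else 0)
    (fun i => by
      split_ifs
      · exact (l.norm_lt h1 _).le
      · simp)
    (fun ρ _ _ => by
      refine tendsto_const_nhds.congr' ((eventually_lt_atBot 0).mono fun i hi => ?_)
      simp [hi.not_ge])

lemma coeff_lplus (h1 : ‖ζ‖ < 1) (i : ℤ) :
    (l.lplus h1).coeff i = if 0 ≤ i then l.seq i.toNat else 0 := rfl

lemma seq_zero_pow : l.seq 0 ^ Nat.card F = -ζ * l.seq 0 := by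
  rw [← l.seq_zero, ← pow_succ, Nat.sub_add_cancel (one_lt_card F).le]

lemma sigma_lplus (h1 : ‖ζ‖ < 1) :
    sigma F (l.lplus h1) = (zpow 1 - const ζ h1.le) * l.lplus h1 := by
  ext i
  rw [coeff_sigma, sub_mul, coeff_sub, coeff_zpow_mul, coeff_const_mul, coeff_lplus, coeff_lplus]
  rcases lt_trichotomy i 0 with hi | rfl | hi
  · rw [if_neg (by omega), if_neg (by omega), zero_pow (one_lt_card F).ne_bot]; simp
  · simp [l.seq_zero_pow]
  · obtain ⟨n, rfl⟩ : ∃ n : ℕ, i = n + 1 := ⟨(i - 1).toNat, by omega⟩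
    rw [if_pos (by omega), if_pos (by omega), add_sub_cancel_right, Int.toNat_natCast,
      show ((n : ℤ) + 1).toNat = n + 1 by omega]
    linear_combination l.seq_succ n

/-- The period `ℓ = ℓ₊ ℓ₋`. -/
def ell (h1 : ‖ζ‖ < 1) : BRig C := l.lplus h1 * lminus F h1

lemma sigma_ell (h1 : ‖ζ‖ < 1) : sigma F (l.ell h1) = zpow 1 * l.ell h1 := by
  have hz : (zpow 1 * zpow (-1) : BRig C) = 1 := zpow_mul_zpow 1 (-1)
  rw [ell, map_mul, sigma_lplus]
  conv_rhs => rw [lminus_eq]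
  linear_combination (const ζ h1.le * l.lplus h1 * sigma F (lminus F h1)) * hz

lemma taylor_ne_zero {b : BRig C} (h0 : ζ ≠ 0) (h1 : ‖ζ‖ < 1) (r : ℝ) (hr : r < ‖b.coeff 0‖)
    (hr0 : 0 ≤ r) (h : ∀ i : ℤ, i ≠ 0 → ‖b.coeff i * ζ ^ i‖ ≤ r) : taylor h0 h1 b ≠ 0 := by
  intro hb
  have h2 : taylorCoeff ζ b 0 = 0 := by rw [← coeff_taylor h0 h1, hb, map_zero]
  have h3 := b.summable_taylor h0 h1 0
  rw [taylorCoeff, pow_zero, inv_one, one_mul, h3.tsum_eq_add_tsum_ite 0] at h2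
  have h4 : b.coeff 0 = -∑' i : ℤ, if i = 0 then 0 else taylorTerm ζ b 0 i := by
    rw [← eq_neg_iff_add_eq_zero] at h2
    rw [← h2]; simp [taylorTerm]
  rw [h4, norm_neg] at hr
  refine absurd hr (not_lt.2 (IsUltrametricDist.norm_tsum_le_of_forall_le_of_nonneg hr0 fun i => ?_))
  split_ifs with hi
  · simpa using hr0
  · simpa [taylorTerm] using h i hi

lemma taylor_lplus_ne_zero (h0 : ζ ≠ 0) (h1 : ‖ζ‖ < 1) : taylor h0 h1 (l.lplus h1) ≠ 0 := by
  have hζ : 0 < ‖ζ‖ := norm_pos_iff.2 h0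
  have hl : ‖ζ‖ ≤ ‖l.seq 0‖ := by
    rw [← norm_neg, ← l.seq_zero, norm_pow]
    exact pow_le_of_le_one (norm_nonneg _) (l.norm_lt h1 0).le
      (by have := one_lt_card F; omega)
  refine taylor_ne_zero h0 h1 (max (‖l.seq 1‖ * ‖ζ‖) (‖ζ‖ ^ 2)) ?_ (by positivity) ?_
  · have h2 := l.norm_lt h1 1
    rw [coeff_lplus, if_pos le_rfl, Int.toNat_zero]
    refine lt_of_lt_of_le (max_lt ?_ ?_) hl <;> nlinarith
  · intro i hi
    rw [coeff_lplus]
    rcases lt_or_gt_of_ne hi with hi | hi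
    · rw [if_neg (by omega)]; simp
    · rw [if_pos hi.le]
      obtain ⟨n, rfl⟩ : ∃ n : ℕ, i = n + 1 := ⟨(i - 1).toNat, by omega⟩
      rw [show ((n : ℤ) + 1).toNat = n + 1 by omega, norm_mul, norm_zpow]
      rcases n with _ | n
      · exact le_max_of_le_left (by simp)
      · refine le_max_of_le_right ?_
        have h3 : ‖ζ‖ ^ (((n + 1 : ℕ) : ℤ) + 1) ≤ ‖ζ‖ ^ 2 := by
          rw [show (((n + 1 : ℕ) : ℤ) + 1) = ((n + 2 : ℕ) : ℤ) by push_cast; ring, zpow_natCast]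
          exact pow_le_pow_of_le_one hζ.le h1.le (by omega)
        exact (mul_le_of_le_one_left (by positivity) (l.norm_lt h1 _).le).trans h3

lemma taylor_sigma_lminus_ne_zero (h0 : ζ ≠ 0) (h1 : ‖ζ‖ < 1) :
    taylor h0 h1 (sigma F (lminus F h1)) ≠ 0 := by
  have hζ : 0 < ‖ζ‖ := norm_pos_iff.2 h0
  refine taylor_ne_zero h0 h1 ‖ζ‖ (by rw [coeff_sigma, lminus_zero]; simpa) hζ.le ?_
  intro i hi
  rcases lt_or_gt_of_ne hi with hi | hi
  · obtain ⟨n, rfl⟩ : ∃ n : ℕ, i = -n := ⟨(-i).toNat, by omega⟩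
    have hn : 1 ≤ n := by omega
    rw [coeff_sigma, norm_mul, norm_pow, norm_zpow, zpow_neg, zpow_natCast, ← div_eq_mul_inv,
      div_le_iff₀ (by positivity), ← pow_succ']
    refine (pow_le_pow_left₀ (norm_nonneg _) (norm_lminusCoeff_le h1 n) _).trans ?_
    rw [← pow_mul]
    refine pow_le_pow_of_le_one hζ.le h1.le ?_
    have h2 := sq_le_geomExp (one_lt_card F) (n + 1)
    rw [geomExp] at h2
    nlinarith
  · rw [coeff_sigma, lminus_pos h1 i hi, zero_pow (one_lt_card F).ne_bot]; simp

/-- The element `z - ζ` is sent to the variable. -/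
lemma taylor_zpow_one_sub (h0 : ζ ≠ 0) (h1 : ‖ζ‖ < 1) :
    taylor h0 h1 (zpow 1 - const ζ h1.le) = PowerSeries.X := by
  ext j
  rw [map_sub, map_sub, coeff_taylor, coeff_taylor, taylorCoeff, taylorCoeff,
    tsum_eq_single 1, tsum_eq_single 0, PowerSeries.coeff_X]
  · have e1 : (Ring.choose (1 : ℤ) j) = (Nat.choose 1 j : ℤ) := by
      simpa using Ring.choose_natCast (R := ℤ) 1 j
    rw [taylorTerm, taylorTerm, e1, Ring.choose_zero_ite, coeff_zpow, coeff_const]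
    rcases j with _ | _ | j
    · simp
    · simp [h0]
    · rw [Nat.choose_eq_zero_of_lt (by omega)]; simp
  · intro i hi; simp [taylorTerm, coeff_const, hi]
  · intro i hi; simp [taylorTerm, coeff_zpow, hi]

lemma taylor_ell_ne_zero (h0 : ζ ≠ 0) (h1 : ‖ζ‖ < 1) : taylor h0 h1 (l.ell h1) ≠ 0 := by
  have hz : (zpow 1 * zpow (-1) : BRig C) = 1 := zpow_mul_zpow 1 (-1)
  have h2 : zpow 1 * lminus F h1 = (zpow 1 - const ζ h1.le) * sigma F (lminus F h1) := by
    conv_lhs => rw [lminus_eq]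
    linear_combination (-const ζ h1.le * sigma F (lminus F h1)) * hz
  rw [ell, map_mul]
  refine mul_ne_zero (l.taylor_lplus_ne_zero h0 h1) fun h => ?_
  have h3 := congrArg (taylor h0 h1) h2
  rw [map_mul, map_mul, h, mul_zero, taylor_zpow_one_sub] at h3
  exact mul_ne_zero PowerSeries.X_ne_zero (taylor_sigma_lminus_ne_zero h0 h1) h3.symm

end DivisionTower
end Period

section Sequence

variable {F : Type*} [Field F] [Finite F]
variable {C : Type*} [NontriviallyNormedField C] [IsUltrametricDist C] [CompleteSpace C]
variable [Algebra F C] {ζ : C} (l : DivisionTower F ζ) (h0 : ζ ≠ 0) (h1 : ‖ζ‖ < 1)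

/-- The embedding of `F((z))` into the field of Laurent series in `X = z - ζ` by expansion at
`z = ζ`, through which `F((z))` acts on the latter. -/
def BRig.scalar : LaurentSeries F →+* LaurentSeries C :=
  (HahnSeries.ofPowerSeries ℤ C).comp ((BRig.taylor h0 h1).comp (BRig.ofLaurent F C))

namespace DivisionTower

open BRig

/-- The localization obtained by inverting `ℓ`. -/
abbrev BRigLoc : Type _ := Localization.Away (l.ell h1)

lemma isUnit_sigma_ell : IsUnit (((algebraMap (BRig C) (l.BRigLoc h1)).comp (sigma F)) (l.ell h1)) := by
  rw [RingHom.comp_apply, sigma_ell, map_mul]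
  refine IsUnit.mul (IsUnit.map _ (IsUnit.of_mul_eq_one (zpow (-1)) (zpow_mul_zpow 1 (-1)))) ?_
  exact IsLocalization.Away.algebraMap_isUnit (l.ell h1)

/-- The unique extension of `sigma` to the localization. -/
def sigmaLoc : l.BRigLoc h1 →+* l.BRigLoc h1 :=
  IsLocalization.Away.lift (l.ell h1) (l.isUnit_sigma_ell h1)

lemma sigmaLoc_algebraMap (b : BRig C) :
    l.sigmaLoc h1 (algebraMap _ _ b) = algebraMap _ _ (sigma F b) :=
  IsLocalization.Away.lift_eq _ _ _

/-- The subring of invariants of `sigmaLoc`. -/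
abbrev invariants : Subring (l.BRigLoc h1) := (l.sigmaLoc h1).eqLocus (RingHom.id _)

lemma isUnit_taylor_ell :
    IsUnit (((HahnSeries.ofPowerSeries ℤ C).comp (taylor h0 h1)) (l.ell h1)) := by
  rw [isUnit_iff_ne_zero, RingHom.comp_apply,
    map_ne_zero_iff _ HahnSeries.ofPowerSeries_injective]
  exact l.taylor_ell_ne_zero h0 h1

/-- The unique extension of the expansion at `z = ζ` to the localization, with values in the field
of Laurent series in the variable `X = z - ζ`. -/
def taylorLoc : l.BRigLoc h1 →+* LaurentSeries C :=
  IsLocalization.Away.lift (l.ell h1) (l.isUnit_taylor_ell h0 h1)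

lemma taylorLoc_algebraMap (b : BRig C) :
    l.taylorLoc h0 h1 (algebraMap _ _ b) = HahnSeries.ofPowerSeries ℤ C (taylor h0 h1 b) :=
  IsLocalization.Away.lift_eq _ _ _

/-- The embedding of `F((z))` into the invariants. -/
def toInvariants : LaurentSeries F →+* l.invariants h1 :=
  ((algebraMap (BRig C) (l.BRigLoc h1)).comp (ofLaurent F C)).codRestrict (l.invariants h1)
    fun a => by
      change l.sigmaLoc h1 (algebraMap _ _ (ofLaurent F C a)) = algebraMap _ _ (ofLaurent F C a)
      rw [sigmaLoc_algebraMap, sigma_ofLaurent]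

/-- The map `a ↦ (a, a)`. -/
def diag : LaurentSeries F →+* l.invariants h1 × PowerSeries C :=
  (l.toInvariants h1).prod ((taylor h0 h1).comp (ofLaurent F C))

/-- The map `(f, g) ↦ f - g`. -/
def diff : l.invariants h1 × PowerSeries C →+ LaurentSeries C :=
  ((l.taylorLoc h0 h1).toAddMonoidHom.comp
      ((l.invariants h1).subtype.toAddMonoidHom.comp (AddMonoidHom.fst _ _))) -
    ((HahnSeries.ofPowerSeries ℤ C).toAddMonoidHom.comp (AddMonoidHom.snd _ _))

lemma diff_apply (x : l.invariants h1 × PowerSeries C) :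
    l.diff h0 h1 x = l.taylorLoc h0 h1 x.1 - HahnSeries.ofPowerSeries ℤ C x.2 := rfl

end DivisionTower
end Sequence

section Closure

variable (K : Type*) [NontriviallyNormedField K] [IsUltrametricDist K] [CompleteSpace K]

/-- An algebraic closure of `K`, with the unique extension of the absolute value. -/
def AlgCl : Type _ := AlgebraicClosure K

instance : Field (AlgCl K) := inferInstanceAs (Field (AlgebraicClosure K))
instance : Algebra K (AlgCl K) := inferInstanceAs (Algebra K (AlgebraicClosure K))
instance : IsAlgClosure K (AlgCl K) := inferInstanceAs (IsAlgClosure K (AlgebraicClosure K))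
instance : Algebra.IsAlgebraic K (AlgCl K) := IsAlgClosure.isAlgebraic
instance : IsAlgClosed (AlgCl K) := IsAlgClosure.isAlgClosed K
instance : NontriviallyNormedField (AlgCl K) := spectralNorm.nontriviallyNormedField K (AlgCl K)
instance : NormedAlgebra K (AlgCl K) := spectralNorm.normedAlgebra K (AlgCl K)

instance : IsUltrametricDist (AlgCl K) := IsUltrametricDist.of_normedAlgebra K

/-- The completion of an algebraic closure of `K`. -/
def Kbar : Type _ := UniformSpace.Completion (AlgCl K)

namespace Kbar

instance : NormedField (Kbar K) := inferInstanceAs (NormedField (UniformSpace.Completion (AlgCl K)))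
instance : CompleteSpace (Kbar K) :=
  inferInstanceAs (CompleteSpace (UniformSpace.Completion (AlgCl K)))

/-- The embedding of the algebraic closure. -/
def ofAlgCl : AlgCl K →+* Kbar K := UniformSpace.Completion.coeRingHom

lemma norm_ofAlgCl (x : AlgCl K) : ‖ofAlgCl K x‖ = ‖x‖ := UniformSpace.Completion.norm_coe x

/-- The embedding of `K`. -/
def ofBase : K →+* Kbar K := (ofAlgCl K).comp (algebraMap K (AlgCl K))

variable {K} in
lemma norm_ofBase (x : K) : ‖ofBase K x‖ = ‖x‖ :=
  (norm_ofAlgCl K _).trans (norm_algebraMap' (AlgCl K) x)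

instance : NontriviallyNormedField (Kbar K) where
  __ := (inferInstance : NormedField (Kbar K))
  non_trivial :=
    let ⟨x, hx⟩ := NontriviallyNormedField.non_trivial (α := K)
    ⟨ofBase K x, hx.trans_eq (norm_ofBase x).symm⟩

instance : IsUltrametricDist (Kbar K) :=
  IsUltrametricDist.isUltrametricDist_of_forall_norm_natCast_le_one fun n => by
    rw [← map_natCast (ofBase K) n, norm_ofBase]
    exact IsUltrametricDist.norm_natCast_le_one K n

instance {F : Type*} [Field F] [Algebra F K] : Algebra F (Kbar K) :=
  ((ofBase K).comp (algebraMap F K)).toAlgebra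

variable {K}

lemma ofBase_ne_zero {ζ : K} (h0 : ζ ≠ 0) : ofBase K ζ ≠ 0 := (map_ne_zero _).2 h0

lemma norm_ofBase_lt {ζ : K} (h1 : ‖ζ‖ < 1) : ‖ofBase K ζ‖ < 1 := (norm_ofBase ζ).trans_lt h1

/-- Over the completion of an algebraic closure there are systems of solutions `ℓ_i`. -/
theorem nonempty_divisionTower (F : Type*) [Field F] [Finite F] (ζ : K) :
    Nonempty (DivisionTower F (ofBase K ζ)) :=
  (DivisionTower.nonempty F (algebraMap K (AlgCl K) ζ)).map fun l => l.map (ofAlgCl K)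

end Kbar

end Closure

end FundSeq

end

/-! Since `σ ℓ = z ℓ`, the invariants of the localization are the quotients `h / ℓ ^ n` with `σ h =
z ^ n h`, and `ℓ` has a simple zero at `ζ`. Everything reduces to two facts about series with `σ h =
z ^ n h`.

Division (`exists_eq_ell_mul`): if `n ≥ 1` and `h` vanishes at `ζ`, then `h = ℓ f` with `σ f = z ^
(n - 1) f`. Iterating, an invariant without pole at `ζ` is a `σ`-fixed series; its coefficients lie
in `F`, and decay leaves finitely many negative ones, so it lies in `F((z))`. This is exactness in
the middle. For the proof write `ℓ = (1 - ζ / z) u` with `u = ℓ₊ σ(ℓ₋)` (`cofactor`). Vanishing at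
`ζ` gives `h = (1 - ζ / z) g`. On an annulus `ρ ^ q ≤ |z| ≤ ρ` containing `|ζ|`, the constant `ℓ_0`
dominates `u`, so `g / u` is a convergent geometric series. The quotient inherits a functional
equation, and this equation propagates a bound from one circle towards the puncture and forces
integral coefficients (`exists_coeff_eq_of_pow_eq`).

Values (`exists_eval_eq`): the solutions of `σ f = z f` take every value at `ζ`. This is the second
assertion; multiplying by powers of a solution with value `1` gives all values for `σ h = z ^ n h`,
`n ≥ 1`, so polar parts can be removed one order at a time, which is surjectivity. The solutions
used are `e(x) = ∑ x ^ (q ^ (-i)) z ^ i` with `|x| < 1`. The value of `e(x)` can be matched to a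
given integral `c` up to a multiple of `ζ` by solving one polynomial equation, which uses that the
completed algebraic closure is algebraically closed. Repeating this on the error gives `c` as the
value of `∑ z ^ n e(x_n)`, and `z e(x) = e(x ^ q)` turns this sum into a single `e(d)`. -/

open Filter Topology

set_option linter.unusedSectionVars false

noncomputable section

namespace FundSeq

/-! ### Gauss norms on circles -/

section Gauss

variable {C : Type*} [NontriviallyNormedField C] [IsUltrametricDist C]

namespace BRig

/-- The Gauss norm of `b` on the circle of radius `ρ` is at most `M`. -/
def GaussLE (ρ M : ℝ) (b : BRig C) : Prop := ∀ i : ℤ, ‖b.coeff i‖ * ρ ^ i ≤ M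

namespace GaussLE

variable {ρ M N : ℝ} {a b : BRig C}

lemma nonneg (h0 : 0 < ρ) (ha : GaussLE ρ M a) : 0 ≤ M :=
  le_trans (by positivity) (ha 0)

lemma mono (ha : GaussLE ρ M a) (h : M ≤ N) : GaussLE ρ N a := fun i => (ha i).trans h

lemma add (h0 : 0 < ρ) (ha : GaussLE ρ M a) (hb : GaussLE ρ M b) : GaussLE ρ M (a + b) := by
  intro i
  have h := mul_le_mul_of_nonneg_right
    (IsUltrametricDist.norm_add_le_max (a.coeff i) (b.coeff i)) (zpow_nonneg h0.le i)
  refine h.trans ?_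
  rw [max_mul_of_nonneg _ _ (zpow_nonneg h0.le i)]
  exact max_le (ha i) (hb i)

lemma neg (ha : GaussLE ρ M a) : GaussLE ρ M (-a) := fun i => by
  have : (-a).coeff i = -a.coeff i := rfl
  rw [this, norm_neg]; exact ha i

lemma sub (h0 : 0 < ρ) (ha : GaussLE ρ M a) (hb : GaussLE ρ M b) : GaussLE ρ M (a - b) := by
  rw [sub_eq_add_neg]; exact ha.add h0 hb.neg

lemma eq_zero (h0 : 0 < ρ) (ha : GaussLE ρ 0 a) : a = 0 := by
  ext i
  have h := ha i
  have h2 : 0 < ρ ^ i := zpow_pos h0 i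
  rw [coeff_zero, ← norm_le_zero_iff]
  exact nonpos_of_mul_nonpos_left h h2

lemma exists_bound (b : BRig C) (h0 : 0 < ρ) (h1 : ρ < 1) : ∃ M, GaussLE ρ M b := by
  obtain ⟨M, hM⟩ := (b.tendsto_cofinite h0 h1).bddAbove_range_of_cofinite
  exact ⟨M, fun i => hM ⟨i, rfl⟩⟩

variable [CompleteSpace C]

lemma mul (h0 : 0 < ρ) (ha : GaussLE ρ M a) (hb : GaussLE ρ N b) : GaussLE ρ (M * N) (a * b) := by
  intro n
  have hM := ha.nonneg h0
  have hN := hb.nonneg h0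
  rw [← le_div_iff₀ (zpow_pos h0 n), coeff_mul]
  refine IsUltrametricDist.norm_tsum_le_of_forall_le_of_nonneg (by positivity) fun i => ?_
  rw [le_div_iff₀ (zpow_pos h0 n), norm_mul]
  have h := mul_le_mul (ha i) (hb (n - i)) (by positivity) hM
  refine le_trans (le_of_eq ?_) h
  have : ρ ^ n = ρ ^ i * ρ ^ (n - i) := by rw [← zpow_add₀ h0.ne']; simp
  rw [this]; ring

lemma zpow (h0 : 0 < ρ) (n : ℤ) : GaussLE ρ (ρ ^ n) (BRig.zpow n : BRig C) := by
  intro i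
  rw [coeff_zpow]
  split_ifs with h
  · simp [h]
  · simp [zpow_nonneg h0.le n]

lemma one (h0 : 0 < ρ) : GaussLE ρ 1 (1 : BRig C) := by
  have h := zpow (C := C) h0 0
  rwa [zpow_zero] at h

lemma pow (h0 : 0 < ρ) (ha : GaussLE ρ M a) (n : ℕ) : GaussLE ρ (M ^ n) (a ^ n) := by
  induction n with
  | zero => simpa using one h0
  | succ n ih => rw [pow_succ, pow_succ]; exact ih.mul h0 ha

lemma const (c : C) (hc : ‖c‖ ≤ 1) : GaussLE ρ ‖c‖ (BRig.const c hc) := by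
  intro i
  rw [coeff_const]
  split_ifs with h
  · simp [h]
  · simp

/-- The Gauss norm is multiplicative for a factor with a dominant term. -/
lemma of_mul (h0 : 0 < ρ) (h1 : ρ < 1) {c : C} (hc : ‖c‖ ≤ 1) {j : ℤ} {m : ℝ}
    (ha : GaussLE ρ m (a - BRig.const c hc * BRig.zpow j)) (hm : m < ‖c‖ * ρ ^ j)
    (hab : GaussLE ρ M (a * b)) : GaussLE ρ (M / (‖c‖ * ρ ^ j)) b := by
  have hm0 := ha.nonneg h0
  set μ := ‖c‖ * ρ ^ j with hμ
  have hμ0 : 0 < μ := hm0.trans_lt hm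
  have hM := hab.nonneg h0
  obtain ⟨B, hB⟩ := exists_bound b h0 h1
  have hbdd : BddAbove (Set.range fun i => ‖b.coeff i‖ * ρ ^ i) :=
    ⟨B, by rintro _ ⟨i, rfl⟩; exact hB i⟩
  have hS : GaussLE ρ (⨆ i, ‖b.coeff i‖ * ρ ^ i) b := fun i => le_ciSup hbdd i
  set S := ⨆ i, ‖b.coeff i‖ * ρ ^ i
  have hS0 := hS.nonneg h0
  -- Isolating the dominant term gives `μ S ≤ max M (m S)` for the exact Gauss norm `S` of `b`. As
  -- `m < μ`, the second alternative forces `S = 0`.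
  have h2 : GaussLE ρ (max M (m * S)) (a * b - (a - BRig.const c hc * BRig.zpow j) * b) :=
    (hab.mono (le_max_left _ _)).sub h0 ((ha.mul h0 hS).mono (le_max_right _ _))
  have h3 : a * b - (a - BRig.const c hc * BRig.zpow j) * b =
      BRig.const c hc * (BRig.zpow j * b) := by ring
  rw [h3] at h2
  have h4 : S ≤ max M (m * S) / μ := by
    refine ciSup_le fun i => ?_
    have h5 := h2 (i + j)
    rw [coeff_const_mul, coeff_zpow_mul, add_sub_cancel_right, norm_mul, zpow_add₀ h0.ne'] at h5
    rw [le_div_iff₀ hμ0, hμ]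
    linarith
  refine hS.mono ?_
  rw [le_div_iff₀ hμ0] at h4 ⊢
  rcases le_max_iff.1 h4 with h | h
  · exact h
  · have : S = 0 := by nlinarith
    rw [this, zero_mul]; exact hM

/-- The value at a point of the circle is bounded by the Gauss norm. -/
lemma norm_tsum_le {ζ : C} (ha : GaussLE ‖ζ‖ M a) (h0 : ζ ≠ 0) :
    ‖∑' i : ℤ, a.coeff i * ζ ^ i‖ ≤ M := by
  refine IsUltrametricDist.norm_tsum_le_of_forall_le_of_nonneg
    (ha.nonneg (norm_pos_iff.2 h0)) fun i => ?_
  rw [norm_mul, norm_zpow]; exact ha i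

end GaussLE

variable [CompleteSpace C]

/-- Evaluation at a point of the punctured open unit disc. -/
def eval {ζ : C} (h0 : ζ ≠ 0) (h1 : ‖ζ‖ < 1) : BRig C →+* C :=
  PowerSeries.constantCoeff.comp (taylor h0 h1)

lemma eval_apply {ζ : C} (h0 : ζ ≠ 0) (h1 : ‖ζ‖ < 1) (b : BRig C) :
    eval h0 h1 b = ∑' i : ℤ, b.coeff i * ζ ^ i := by
  rw [eval, RingHom.comp_apply, ← PowerSeries.coeff_zero_eq_constantCoeff_apply, coeff_taylor,
    taylorCoeff]
  simp [taylorTerm]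

lemma hasSum_eval {ζ : C} (h0 : ζ ≠ 0) (h1 : ‖ζ‖ < 1) (b : BRig C) :
    HasSum (fun i : ℤ => b.coeff i * ζ ^ i) (eval h0 h1 b) := by
  rw [eval_apply]; exact (b.summable_weight h0 h1).hasSum

lemma eval_zpow {ζ : C} (h0 : ζ ≠ 0) (h1 : ‖ζ‖ < 1) (n : ℤ) :
    eval h0 h1 (zpow n) = ζ ^ n := by
  rw [eval_apply, tsum_eq_single n]
  · simp [coeff_zpow]
  · intro i hi; simp [coeff_zpow, hi]

lemma eval_const {ζ : C} (h0 : ζ ≠ 0) (h1 : ‖ζ‖ < 1) (c : C) (hc : ‖c‖ ≤ 1) :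
    eval h0 h1 (const c hc) = c := by
  rw [eval_apply, tsum_eq_single 0]
  · simp [coeff_const]
  · intro i hi; simp [coeff_const, hi]

/-! ### Division by `1 - ζ / z` -/

section Division

variable {ζ : C} {h : BRig C}

lemma summable_shift (h0 : ζ ≠ 0) (h1 : ‖ζ‖ < 1) (h : BRig C) (i : ℤ) :
    Summable fun k : ℤ => ζ ^ k * h.coeff (i + k) := by
  have := ((h.summable_weight h0 h1).comp_injective (add_right_injective i)).mul_left (ζ ^ (-i))
  refine this.congr fun k => ?_
  have e : ζ ^ (-i) * ζ ^ (i + k) = ζ ^ k := by rw [← zpow_add₀ h0]; simp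
  simp only [Function.comp]
  linear_combination (h.coeff (i + k)) * e

lemma tsum_shift_eq_zero (h0 : ζ ≠ 0) (h1 : ‖ζ‖ < 1) (hh : eval h0 h1 h = 0) (i : ℤ) :
    ∑' k : ℤ, ζ ^ k * h.coeff (i + k) = 0 := by
  rw [eval_apply, ← (Equiv.addLeft i).tsum_eq] at hh
  have : ∀ k : ℤ, ζ ^ k * h.coeff (i + k) =
      ζ ^ (-i) * (h.coeff (Equiv.addLeft i k) * ζ ^ (Equiv.addLeft i k)) := fun k => by
    have e : ζ ^ (-i) * ζ ^ (i + k) = ζ ^ k := by rw [← zpow_add₀ h0]; simp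
    rw [Equiv.coe_addLeft]
    linear_combination -(h.coeff (i + k)) * e
  rw [tsum_congr this, tsum_mul_left, hh, mul_zero]

/-- The coefficients of the quotient of `h` by `1 - ζ / z`. -/
def divCoeff (ζ : C) (h : BRig C) (i : ℤ) : C := ∑' k : ℕ, ζ ^ k * h.coeff (i + k)

lemma summable_divCoeff (h0 : ζ ≠ 0) (h1 : ‖ζ‖ < 1) (h : BRig C) (i : ℤ) :
    Summable fun k : ℕ => ζ ^ k * h.coeff (i + k) :=
  ((summable_shift h0 h1 h i).comp_injective Nat.cast_injective).congr fun k => by simp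

/-- The sum over all integers `k` is `ζ ^ (-i) h(ζ) = 0`. The first form of the quotient coefficient
shows integrality; this one involves only coefficients of `h` of index below `i`, hence shows decay
for `i → -∞`. -/
lemma divCoeff_eq_neg (h0 : ζ ≠ 0) (h1 : ‖ζ‖ < 1) (hh : eval h0 h1 h = 0) (i : ℤ) :
    divCoeff ζ h i = -∑' k : ℕ, ζ ^ (-((k : ℤ) + 1)) * h.coeff (i + -((k : ℤ) + 1)) := by
  have hneg : Summable fun k : ℕ => ζ ^ (-((k : ℤ) + 1)) * h.coeff (i + -((k : ℤ) + 1)) :=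
    (summable_shift h0 h1 h i).comp_injective (i := fun k : ℕ => (-((k : ℤ) + 1)))
      (fun a b hab => by simpa using hab)
  have hpos : Summable fun k : ℕ => ζ ^ (k : ℤ) * h.coeff (i + k) := by
    simpa using summable_divCoeff h0 h1 h i
  have := tsum_of_nat_of_neg_add_one (f := fun k : ℤ => ζ ^ k * h.coeff (i + k)) hpos hneg
  rw [tsum_shift_eq_zero h0 h1 hh i] at this
  simp only [zpow_natCast] at this
  exact eq_neg_of_add_eq_zero_left this.symm

lemma norm_divCoeff_mul_le (h0 : ζ ≠ 0) (h1 : ‖ζ‖ < 1) (hh : eval h0 h1 h = 0) {ρ ε : ℝ}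
    (hρ : 0 < ρ) (hρζ : ρ ≤ ‖ζ‖) (hε : 0 ≤ ε) {i : ℤ}
    (hi : ∀ j < i, ‖h.coeff j‖ * ρ ^ j ≤ ε) : ‖divCoeff ζ h i‖ * ρ ^ i ≤ ε := by
  have hρi := zpow_pos hρ i
  rw [← le_div_iff₀ hρi, divCoeff_eq_neg h0 h1 hh, norm_neg]
  refine IsUltrametricDist.norm_tsum_le_of_forall_le_of_nonneg (by positivity) fun k => ?_
  rw [le_div_iff₀ hρi, norm_mul, norm_zpow]
  refine le_trans ?_ (hi (i + -((k : ℤ) + 1)) (by omega))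
  have h4 : ‖ζ‖ ^ (-((k : ℤ) + 1)) ≤ ρ ^ (-((k : ℤ) + 1)) := by
    rw [zpow_neg, zpow_neg]
    exact inv_anti₀ (zpow_pos hρ _) (zpow_le_zpow_left₀ (by omega) hρ.le hρζ)
  calc _ = ‖ζ‖ ^ (-((k : ℤ) + 1)) * (‖h.coeff (i + -((k : ℤ) + 1))‖ * ρ ^ i) := by ring
    _ ≤ ρ ^ (-((k : ℤ) + 1)) * (‖h.coeff (i + -((k : ℤ) + 1))‖ * ρ ^ i) :=
      mul_le_mul_of_nonneg_right h4 (by positivity)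
    _ = _ := by rw [zpow_add₀ hρ.ne' i]; ring

lemma tendsto_divCoeff (h0 : ζ ≠ 0) (h1 : ‖ζ‖ < 1) (hh : eval h0 h1 h = 0) {ρ : ℝ}
    (hρ : 0 < ρ) (hρζ : ρ ≤ ‖ζ‖) :
    Tendsto (fun i : ℤ => ‖divCoeff ζ h i‖ * ρ ^ i) atBot (𝓝 0) := by
  have := h.tendsto_atBot hρ (hρζ.trans_lt h1)
  rw [Metric.tendsto_nhds] at this ⊢
  intro ε hε
  obtain ⟨n, hn⟩ := eventually_atBot.1 (this (ε / 2) (half_pos hε))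
  filter_upwards [eventually_le_atBot n] with i hi
  rw [Real.dist_eq, sub_zero, abs_of_nonneg (by positivity)]
  refine (norm_divCoeff_mul_le h0 h1 hh hρ hρζ (half_pos hε).le fun j hj => ?_).trans_lt
    (half_lt_self hε)
  have h3 := hn j (by omega)
  rw [Real.dist_eq, sub_zero, abs_of_nonneg (by positivity)] at h3
  exact h3.le

lemma norm_divCoeff_le (h1 : ‖ζ‖ < 1) (h : BRig C) (i : ℤ) : ‖divCoeff ζ h i‖ ≤ 1 :=
  IsUltrametricDist.norm_tsum_le_of_forall_le_of_nonneg zero_le_one fun k => by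
    rw [norm_mul]
    exact mul_le_one₀ (norm_pow_le_one h1 k) (norm_nonneg _) (h.norm_coeff_le _)

lemma divCoeff_succ (h0 : ζ ≠ 0) (h1 : ‖ζ‖ < 1) (h : BRig C) (i : ℤ) :
    divCoeff ζ h i = h.coeff i + ζ * divCoeff ζ h (i + 1) := by
  rw [divCoeff, divCoeff, (summable_divCoeff h0 h1 h i).tsum_eq_zero_add, ← tsum_mul_left]
  congr 1
  · simp
  · refine tsum_congr fun k => ?_
    rw [pow_succ', mul_assoc, Nat.cast_succ, add_assoc, add_comm (1 : ℤ)]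

/-- A series that vanishes at `ζ` is divisible by `1 - ζ / z`. -/
lemma exists_eq_one_sub_mul (h0 : ζ ≠ 0) (h1 : ‖ζ‖ < 1) (hh : eval h0 h1 h = 0) :
    ∃ g : BRig C, h = (1 - const ζ h1.le * zpow (-1)) * g := by
  have hζ : 0 < ‖ζ‖ := norm_pos_iff.2 h0
  refine ⟨mk (divCoeff ζ h) (norm_divCoeff_le h1 h) fun ρ hρ0 hρ1 => ?_, ?_⟩
  -- For `i ≤ 0` a smaller radius only makes the weight larger, so radii up to `|ζ|` suffice.
  · refine squeeze_zero' (Eventually.of_forall fun i => by positivity) ?_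
      (tendsto_divCoeff h0 h1 hh (lt_min hρ0 hζ) (min_le_right ρ _))
    filter_upwards [eventually_le_atBot 0] with i hi
    refine mul_le_mul_of_nonneg_left ?_ (norm_nonneg _)
    obtain ⟨n, rfl⟩ : ∃ n : ℕ, i = -n := ⟨(-i).toNat, by omega⟩
    rw [zpow_neg, zpow_neg]
    exact inv_anti₀ (by positivity)
      (zpow_le_zpow_left₀ (by omega) (by positivity) (min_le_left _ _))
  · ext i
    rw [coeff_one_sub_mul, coeff_mk, coeff_mk, divCoeff_succ h0 h1 h i, add_sub_cancel_right]

end Division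

end BRig
end Gauss

/-! ### Series with `σ f = z ^ m f` -/

section Eigen

variable (F : Type*) [Field F] [Finite F]
variable {C : Type*} [NontriviallyNormedField C] [IsUltrametricDist C]

namespace BRig

/-- A Laurent series that is bounded on one circle and satisfies the functional equation
`σ f = z ^ m f`, `m ≥ 0`, lies in the ring `BRig C`. -/
lemma exists_coeff_eq_of_pow_eq {q : ℕ} (hq : 1 < q) (b : ℤ → C) (m : ℕ)
    (hb : ∀ i, b i ^ q = b (i - m)) {ρ M : ℝ} (h0 : 0 < ρ) (h1 : ρ < 1)
    (hM : ∀ i, ‖b i‖ * ρ ^ i ≤ M) : ∃ f : BRig C, ∀ i, f.coeff i = b i := by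
  have hpow : ∀ (k : ℕ) (i : ℤ), ‖b i‖ ^ q ^ k = ‖b (i - k * m)‖ := by
    intro k
    induction k with
    | zero => intro i; simp
    | succ k ih =>
      intro i
      rw [pow_succ, pow_mul, ih, ← norm_pow, hb]
      congr 2; push_cast; ring
  -- Iterating the equation `k` times turns the bound at radius `ρ` into one at radius `ρ ^ (q ^
  -- k)`, and these radii tend to `0`.
  have hbound : ∀ k : ℕ, ∃ M', ∀ i, ‖b i‖ * (ρ ^ q ^ k) ^ i ≤ M' := by
    intro k
    refine ⟨M ^ q ^ k * (ρ ^ q ^ k) ^ (-(k * m : ℤ)), fun i => ?_⟩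
    have h2 := hpow k (i + k * m)
    rw [add_sub_cancel_right] at h2
    have h3 : (ρ ^ q ^ k) ^ i = (ρ ^ (i + k * m)) ^ q ^ k * (ρ ^ q ^ k) ^ (-(k * m : ℤ)) := by
      rw [← zpow_natCast (ρ ^ (i + k * m)), zpow_comm, ← zpow_natCast ρ,
        ← zpow_add₀ (zpow_pos h0 _).ne', ]
      congr 1
      ring
    rw [← h2, h3, ← mul_assoc, ← mul_pow]
    exact mul_le_mul_of_nonneg_right (pow_le_pow_left₀ (by positivity) (hM _) _) (by positivity)
  refine ⟨mk b (fun i => ?_) fun ρ' h0' h1' => ?_, fun i => rfl⟩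
  -- If `|b_i| > 1`, then `|b_{i - km}| = |b_i| ^ (q ^ k)` tends to infinity with `k`, although the
  -- bound on the circle keeps it below `M ρ ^ (-i)`.
  · by_contra! hi
    have hlim : Tendsto (fun k : ℕ => ‖b i‖ ^ q ^ k) atTop atTop :=
      (tendsto_pow_atTop_atTop_of_one_lt hi).comp (tendsto_pow_atTop_atTop_of_one_lt hq)
    obtain ⟨k, hk⟩ := (hlim.eventually_gt_atTop (M * ρ ^ (-i))).exists
    refine absurd hk (not_lt.2 ?_)
    rw [hpow]
    have h2 := hM (i - k * m)
    have h3 : ρ ^ i ≤ ρ ^ (i - k * m) :=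
      zpow_le_zpow_right_of_le_one₀ h0 h1.le (by have : (0 : ℤ) ≤ k * m := by positivity
                                                 omega)
    rw [zpow_neg, ← div_eq_mul_inv, le_div_iff₀ (zpow_pos h0 i)]
    exact (mul_le_mul_of_nonneg_left h3 (norm_nonneg _)).trans h2
  -- Boundedness at some radius `r < ρ'` gives convergence to `0` at radius `ρ'`, at the rate `(r /
  -- ρ') ^ n`.
  · have hlim : Tendsto (fun k : ℕ => ρ ^ q ^ k) atTop (𝓝 0) :=
      (tendsto_pow_atTop_nhds_zero_of_lt_one h0.le h1).comp (tendsto_pow_atTop_atTop_of_one_lt hq)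
    obtain ⟨k, hk⟩ := (hlim.eventually_lt_const h0').exists
    obtain ⟨M', hM'⟩ := hbound k
    set r := ρ ^ q ^ k
    have hr0 : 0 < r := by positivity
    have hlim2 : Tendsto (fun i : ℤ => M' * (r / ρ') ^ (-i).toNat) atBot (𝓝 (M' * 0)) :=
      ((tendsto_pow_atTop_nhds_zero_of_lt_one (by positivity) ((div_lt_one h0').2 hk)).comp
        (tendsto_atTop.2 fun n =>
          (eventually_le_atBot (-(n : ℤ))).mono fun i hi => by omega)).const_mul _
    rw [mul_zero] at hlim2
    refine squeeze_zero' (Eventually.of_forall fun i => by positivity) ?_ hlim2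
    filter_upwards [eventually_le_atBot 0] with i hi
    obtain ⟨n, rfl⟩ : ∃ n : ℕ, i = -n := ⟨(-i).toNat, by omega⟩
    have h2 := mul_le_mul_of_nonneg_right (hM' (-n)) (by positivity : 0 ≤ (r / ρ') ^ n)
    rw [neg_neg, Int.toNat_natCast]
    refine le_trans (le_of_eq ?_) h2
    rw [div_pow, zpow_neg, zpow_neg, zpow_natCast, zpow_natCast]
    field_simp

variable [CompleteSpace C] [Algebra F C]

/-- The polynomial `X ^ q - X` has at most `q` roots, and `F` already supplies `q` of them. -/
lemma exists_algebraMap_eq {x : C} (hx : x ^ Nat.card F = x) : ∃ a : F, algebraMap F C a = x := by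
  have := Fintype.ofFinite F
  have hinj := FaithfulSMul.algebraMap_injective F C
  by_contra! hcon
  have hq := one_lt_card F
  have hne : (Polynomial.X ^ Nat.card F - Polynomial.X : Polynomial C) ≠ 0 :=
    FiniteField.X_pow_card_sub_X_ne_zero C hq
  have hcard := Polynomial.card_roots' (Polynomial.X ^ Nat.card F - Polynomial.X : Polynomial C)
  rw [FiniteField.X_pow_card_sub_X_natDegree_eq C hq] at hcard
  classical
  have hsub : insert x (Finset.univ.image (algebraMap F C)) ⊆
      (Polynomial.X ^ Nat.card F - Polynomial.X : Polynomial C).roots.toFinset := by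
    intro y hy
    rw [Multiset.mem_toFinset, Polynomial.mem_roots hne, Polynomial.IsRoot, Polynomial.eval_sub,
      Polynomial.eval_pow, Polynomial.eval_X, sub_eq_zero]
    rcases Finset.mem_insert.1 hy with rfl | hy
    · exact hx
    · obtain ⟨a, -, rfl⟩ := Finset.mem_image.1 hy
      rw [← map_pow, Nat.card_eq_fintype_card, FiniteField.pow_card]
  have h2 := (Finset.card_le_card hsub).trans (Multiset.toFinset_card_le _)
  rw [Finset.card_insert_of_notMem (by simpa using hcon), Finset.card_image_of_injective _ hinj,
    Finset.card_univ, ← Nat.card_eq_fintype_card] at h2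
  omega

/-- The invariants of `sigma` are the Laurent series over `F`. -/
lemma exists_ofLaurent_eq {h : BRig C} (hh : sigma F h = h) :
    ∃ a : LaurentSeries F, ofLaurent F C a = h := by
  have h2 : ∀ i, ∃ a : F, algebraMap F C a = h.coeff i := fun i =>
    exists_algebraMap_eq F (by rw [← coeff_sigma, hh])
  choose a ha using h2
  -- A non-zero coefficient satisfies `x ^ q = x`, so it has absolute value `1`. Decay for `i → -∞`
  -- therefore makes the coefficients vanish eventually.
  have hb : BddBelow (Function.support a) := by
    obtain ⟨w, hw0, hw1⟩ := exists_weight (C := C)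
    have hw := norm_pos_iff.2 hw0
    obtain ⟨n, hn⟩ := eventually_atBot.1 ((h.tendsto_atBot hw hw1).eventually_lt_const one_pos)
    refine ⟨min n 0, fun i hi => ?_⟩
    by_contra! hlt
    have h3 := hn i (hlt.le.trans (min_le_left _ _))
    have h4 : ‖h.coeff i‖ = 1 := by
      have h5 : h.coeff i ≠ 0 := by
        rw [← ha]; exact (map_ne_zero _).2 hi
      have h6 : ‖h.coeff i‖ ^ Nat.card F = ‖h.coeff i‖ := by rw [← norm_pow, ← coeff_sigma, hh]
      have h7 := (mul_eq_right₀ (norm_ne_zero_iff.2 h5)).1 ((pow_sub_one_mul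
        (one_lt_card F).ne_bot ‖h.coeff i‖).trans h6)
      exact (pow_eq_one_iff_of_nonneg (norm_nonneg _)
        (by have := one_lt_card F; omega)).1 h7
    rw [h4, one_mul] at h3
    have h5 : 1 ≤ ‖w‖ ^ i := one_le_zpow_of_nonpos₀ hw hw1.le (hlt.le.trans (min_le_right _ _))
    linarith
  refine ⟨HahnSeries.ofSuppBddBelow a hb, ?_⟩
  ext i
  rw [coeff_ofLaurent, HahnSeries.coeff_ofSuppBddBelow, ha]

end BRig
end Eigen

/-! ### The factors of `ℓ` near the circle of radius `|ζ|` -/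

section Quotient

variable {F : Type*} [Field F] [Finite F]
variable {C : Type*} [NontriviallyNormedField C] [IsUltrametricDist C] [CompleteSpace C]
variable [Algebra F C] {ζ : C}

/-- A sequence whose successive differences decay geometrically converges, with the same rate. -/
lemma exists_limit_of_norm_sub_le (a : ℕ → C) {D θ : ℝ} (hD : 0 ≤ D) (hθ0 : 0 ≤ θ) (hθ1 : θ < 1)
    (ha : ∀ N, ‖a (N + 1) - a N‖ ≤ D * θ ^ N) : ∃ x, ∀ N, ‖x - a N‖ ≤ D * θ ^ N := by
  have hlim : Tendsto (fun N : ℕ => D * θ ^ N) atTop (𝓝 0) := by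
    simpa using (tendsto_pow_atTop_nhds_zero_of_lt_one hθ0 hθ1).const_mul D
  obtain ⟨x, hx⟩ := cauchySeq_tendsto_of_complete
    (NonarchimedeanAddGroup.cauchySeq_of_tendsto_sub_nhds_zero
      (tendsto_zero_iff_norm_tendsto_zero.2 (squeeze_zero (fun _ => norm_nonneg _) ha hlim)))
  refine ⟨x, fun N => ?_⟩
  have h : ∀ k, ‖a (N + k) - a N‖ ≤ D * θ ^ N := by
    intro k
    induction k with
    | zero => simp; positivity
    | succ k ih =>
      have e : a (N + (k + 1)) - a N = (a (N + k + 1) - a (N + k)) + (a (N + k) - a N) := by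
        rw [add_assoc]; ring
      rw [e]
      refine (IsUltrametricDist.norm_add_le_max _ _).trans (max_le ((ha _).trans ?_) ih)
      exact mul_le_mul_of_nonneg_left (pow_le_pow_of_le_one hθ0 hθ1.le (by omega)) hD
  refine le_of_tendsto ((((tendsto_add_atTop_iff_nat N).2 hx).sub_const (a N)).norm)
    (Eventually.of_forall fun k => ?_)
  rw [add_comm k N]; exact h k

/-- There is a radius `ρ` with `ρ ^ q < |ζ| < ρ < 1`. -/
lemma exists_radius {q : ℕ} (hq : 1 < q) {s : ℝ} (h0 : 0 < s) (h1 : s < 1) :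
    ∃ ρ, s < ρ ∧ ρ < 1 ∧ ρ ^ q < s := by
  have hc : ContinuousWithinAt (fun x : ℝ => x ^ q) (Set.Ioi s) s := by fun_prop
  have h2 : s ^ q < s := pow_lt_self_of_lt_one₀ h0 h1 hq
  have h3 := hc.eventually_lt_const h2
  have h4 : ∀ᶠ x in 𝓝[>] s, x < 1 := nhdsWithin_le_nhds (eventually_lt_nhds h1)
  obtain ⟨ρ, ⟨h5, h6⟩, h7⟩ := ((h3.and h4).and self_mem_nhdsWithin).exists
  exact ⟨ρ, h7, h6, h5⟩

namespace BRig

lemma GaussLE.sigma {ρ M : ℝ} {b : BRig C} (h0 : 0 < ρ) (hb : GaussLE ρ M b) :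
    GaussLE (ρ ^ Nat.card F) (M ^ Nat.card F) (BRig.sigma F b) := by
  intro i
  rw [coeff_sigma, norm_pow, ← zpow_natCast ρ, zpow_comm, zpow_natCast, ← mul_pow]
  exact pow_le_pow_left₀ (by positivity) (hb i) _

lemma sigma_const (c : C) (hc : ‖c‖ ≤ 1) :
    BRig.sigma F (const c hc) = const c hc ^ Nat.card F := by
  have h : ∀ n : ℕ, n ≠ 0 → ∀ i, (const c hc ^ n).coeff i = if i = 0 then c ^ n else 0 := by
    intro n hn
    induction n, Nat.one_le_iff_ne_zero.2 hn using Nat.le_induction with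
    | base => intro i; rw [pow_one, pow_one, coeff_const]
    | succ n hn ih =>
      intro i
      rw [pow_succ', coeff_const_mul, ih (by omega)]
      split_ifs <;> ring
  ext i
  rw [coeff_sigma, coeff_const, h _ (one_lt_card F).ne_bot]
  split_ifs
  · rfl
  · exact zero_pow (one_lt_card F).ne_bot

lemma coeff_const_pow_mul (c : C) (hc : ‖c‖ ≤ 1) (n : ℕ) (a : BRig C) (i : ℤ) :
    (const c hc ^ n * a).coeff i = c ^ n * a.coeff i := by
  induction n with
  | zero => simp
  | succ n ih => rw [pow_succ', mul_assoc, coeff_const_mul, ih, pow_succ', mul_assoc]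

lemma coeff_sigma_lminus_le (h1 : ‖ζ‖ < 1) (n : ℕ) :
    ‖(sigma F (lminus F h1)).coeff (-n)‖ ≤ (‖ζ‖ ^ Nat.card F) ^ n := by
  rw [coeff_sigma, norm_pow]
  refine (pow_le_pow_left₀ (norm_nonneg _) (norm_lminusCoeff_le h1 n) _).trans ?_
  rw [← pow_mul, ← pow_mul]
  refine pow_le_pow_of_le_one (norm_nonneg _) h1.le ?_
  rw [mul_comm]
  exact Nat.mul_le_mul_right _ (le_geomExp (one_lt_card F) n)

/-- The zeros of `σ(ℓ₋)` are the `ζ ^ (q ^ i)` with `i ≥ 1`. They lie inside the circle of radius `ρ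
^ q`, so from there outwards the constant term `1` dominates. -/
lemma gaussLE_sigma_lminus_sub_one (h1 : ‖ζ‖ < 1) {ρ r : ℝ} (hρ0 : 0 < ρ) (hρ : ‖ζ‖ < ρ)
    (hr : ρ ^ Nat.card F ≤ r) : GaussLE r (‖ζ‖ / ρ) (sigma F (lminus F h1) - 1) := by
  have hr0 : 0 < r := (pow_pos hρ0 _).trans_le hr
  have hpos : 0 ≤ ‖ζ‖ / ρ := by positivity
  have hlt : ‖ζ‖ / ρ < 1 := (div_lt_one hρ0).2 hρ
  intro i
  rw [coeff_sub, coeff_one]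
  rcases lt_trichotomy i 0 with hi | rfl | hi
  · obtain ⟨n, rfl⟩ : ∃ n : ℕ, i = -n := ⟨(-i).toNat, by omega⟩
    have hn : n ≠ 0 := by omega
    rw [if_neg hi.ne, sub_zero, zpow_neg, zpow_natCast, ← div_eq_mul_inv]
    calc _ ≤ (‖ζ‖ ^ Nat.card F) ^ n / (ρ ^ Nat.card F) ^ n := by
          gcongr; exact coeff_sigma_lminus_le h1 n
      _ = (‖ζ‖ / ρ) ^ (Nat.card F * n) := by rw [← div_pow, ← div_pow, pow_mul]
      _ ≤ ‖ζ‖ / ρ := pow_le_of_le_one hpos hlt.le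
          (Nat.mul_ne_zero (one_lt_card F).ne_bot hn)
  · rw [coeff_sigma, lminus_zero]; simpa
  · rw [coeff_sigma, lminus_pos h1 i hi, zero_pow (one_lt_card F).ne_bot, if_neg hi.ne']
    simpa

end BRig

namespace DivisionTower

open BRig

variable (l : DivisionTower F ζ)

lemma norm_seq_zero_pow : ‖l.seq 0‖ ^ (Nat.card F - 1) = ‖ζ‖ := by
  rw [← norm_pow, l.seq_zero, norm_neg]

lemma norm_seq_zero_pos (h0 : ζ ≠ 0) : 0 < ‖l.seq 0‖ := by
  rw [norm_pos_iff]
  intro h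
  have h2 := l.seq_zero
  rw [h, zero_pow (by have := one_lt_card F; omega), zero_eq_neg] at h2
  exact h0 h2

/-- In `ℓ_1 ^ q = ℓ_0 - ζ ℓ_1` the last term is no larger than `ℓ_0`, because `|ζ| = |ℓ_0| ^ (q - 1)
≤ |ℓ_0|`. -/
lemma norm_seq_one_pow_le (h1 : ‖ζ‖ < 1) : ‖l.seq 1‖ ^ Nat.card F ≤ ‖l.seq 0‖ := by
  have hq := one_lt_card F
  have h : ‖ζ‖ ≤ ‖l.seq 0‖ := by
    rw [← l.norm_seq_zero_pow]
    exact pow_le_of_le_one (norm_nonneg _) (l.norm_lt h1 0).le (by omega)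
  rw [← norm_pow, eq_sub_of_add_eq (l.seq_succ 0), sub_eq_add_neg]
  refine (IsUltrametricDist.norm_add_le_max _ _).trans (max_le le_rfl ?_)
  rw [norm_neg, norm_mul]
  exact (mul_le_of_le_one_right (norm_nonneg _) (l.norm_lt h1 1).le).trans h

/-- On circles of radius `r ≤ ρ`, where `ρ ^ q < |ζ|`, the constant term of `ℓ₊` dominates. -/
lemma exists_gaussLE_lplus (h0 : ζ ≠ 0) (h1 : ‖ζ‖ < 1) {ρ : ℝ} (hρ0 : 0 < ρ) (hρ1 : ρ < 1)
    (hρ : ρ ^ Nat.card F < ‖ζ‖) : ∃ m, m < ‖l.seq 0‖ ∧ ∀ r, 0 < r → r ≤ ρ →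
      GaussLE r m (l.lplus h1 - const (l.seq 0) (l.norm_lt h1 0).le) := by
  have hq := one_lt_card F
  have hl := l.norm_seq_zero_pos h0
  -- The linear term is compared with `ℓ_0` after raising to the power `q`. All later terms are at
  -- most `ρ ^ 2`, which is compared after raising to the power `q - 1`, using `2 (q - 1) ≥ q`.
  refine ⟨max (‖l.seq 1‖ * ρ) (ρ ^ 2), max_lt ?_ ?_, fun r hr0 hr i => ?_⟩
  · refine lt_of_pow_lt_pow_left₀ (Nat.card F) hl.le ?_
    rw [mul_pow]
    calc _ ≤ ‖l.seq 0‖ * ρ ^ Nat.card F :=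
          mul_le_mul_of_nonneg_right (l.norm_seq_one_pow_le h1) (by positivity)
      _ < ‖l.seq 0‖ * ‖ζ‖ := mul_lt_mul_of_pos_left hρ hl
      _ = ‖l.seq 0‖ ^ Nat.card F := by
        rw [← l.norm_seq_zero_pow, ← pow_succ', Nat.sub_add_cancel hq.le]
  · refine lt_of_pow_lt_pow_left₀ (Nat.card F - 1) hl.le ?_
    rw [l.norm_seq_zero_pow, ← pow_mul]
    exact (pow_le_pow_of_le_one hρ0.le hρ1.le (by omega)).trans_lt hρ
  · have hnn : 0 ≤ max (‖l.seq 1‖ * ρ) (ρ ^ 2) := le_max_of_le_right (by positivity)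
    rw [coeff_sub, coeff_const, coeff_lplus]
    rcases lt_trichotomy i 0 with hi | rfl | hi
    · rw [if_neg (by omega), if_neg hi.ne]; simpa using hnn
    · simpa using hnn
    · obtain ⟨n, rfl⟩ : ∃ n : ℕ, i = n + 1 := ⟨(i - 1).toNat, by omega⟩
      rw [if_pos hi.le, if_neg hi.ne', sub_zero, show ((n : ℤ) + 1).toNat = n + 1 by omega,
        ← Nat.cast_succ, zpow_natCast]
      rcases n with _ | n
      · refine le_max_of_le_left ?_
        rw [pow_one]; exact mul_le_mul_of_nonneg_left hr (norm_nonneg _)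
      · refine le_max_of_le_right ?_
        calc _ ≤ r ^ (n + 1 + 1) := mul_le_of_le_one_left (by positivity) (l.norm_lt h1 _).le
          _ ≤ ρ ^ (n + 1 + 1) := pow_le_pow_left₀ hr0.le hr _
          _ ≤ ρ ^ 2 := pow_le_pow_of_le_one hρ0.le hρ1.le (by omega)

/-- The factor `ℓ₊ σ(ℓ₋)` of `ℓ`, which has no zeros near the circle of radius `|ζ|`. -/
def cofactor (h1 : ‖ζ‖ < 1) : BRig C := l.lplus h1 * sigma F (lminus F h1)

lemma ell_eq (h1 : ‖ζ‖ < 1) : l.ell h1 = (1 - const ζ h1.le * zpow (-1)) * l.cofactor h1 := by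
  rw [ell, cofactor]
  conv_lhs => rw [lminus_eq]
  ring

/-- The constant term minus the cofactor. -/
def remainder (h1 : ‖ζ‖ < 1) : BRig C :=
  const (l.seq 0) (l.norm_lt h1 0).le - l.cofactor h1

/-- On this annulus both factors of the cofactor have dominant constant term. A single `m` must
serve all radii: the division theorem uses the bound at `ρ ^ q` directly, and the bound at `ρ`
through `σ`. -/
lemma exists_gaussLE_remainder (h0 : ζ ≠ 0) (h1 : ‖ζ‖ < 1) {ρ : ℝ} (hρζ : ‖ζ‖ < ρ) (hρ1 : ρ < 1)
    (hρ : ρ ^ Nat.card F < ‖ζ‖) : ∃ m, m < ‖l.seq 0‖ ∧ ∀ r, ρ ^ Nat.card F ≤ r → r ≤ ρ →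
      GaussLE r m (l.remainder h1) := by
  have hρ0 : 0 < ρ := (norm_nonneg ζ).trans_lt hρζ
  have hl := l.norm_seq_zero_pos h0
  have hlt : ‖ζ‖ / ρ < 1 := (div_lt_one hρ0).2 hρζ
  obtain ⟨m, hm, H⟩ := l.exists_gaussLE_lplus h0 h1 hρ0 hρ1 hρ
  refine ⟨max m (‖l.seq 0‖ * (‖ζ‖ / ρ)), max_lt hm (mul_lt_of_lt_one_right hl hlt),
    fun r hr hr' => ?_⟩
  have hr0 : 0 < r := (pow_pos hρ0 _).trans_le hr
  have h2 := gaussLE_sigma_lminus_sub_one (F := F) h1 hρ0 hρζ hr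
  have h3 : GaussLE r 1 (sigma F (lminus F h1)) := by
    simpa using (h2.mono hlt.le).add hr0 (GaussLE.one hr0)
  have h4 := (((H r hr0 hr').mul hr0 h3).mono (by rw [mul_one]; exact le_max_left _ _)).add hr0
    (((GaussLE.const (ρ := r) (l.seq 0) (l.norm_lt h1 0).le).mul hr0 h2).mono (le_max_right m _))
  have h5 : l.remainder h1 = -((l.lplus h1 - const (l.seq 0) (l.norm_lt h1 0).le) *
      sigma F (lminus F h1) + const (l.seq 0) (l.norm_lt h1 0).le *
      (sigma F (lminus F h1) - 1)) := by
    rw [remainder, cofactor]; ring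
  rw [h5]; exact h4.neg

/-- The circle through `ζ` lies in the annulus where `ℓ_0` dominates. This makes the zero of `ℓ` at
`ζ` simple. -/
lemma eval_cofactor_ne_zero (h0 : ζ ≠ 0) (h1 : ‖ζ‖ < 1) : eval h0 h1 (l.cofactor h1) ≠ 0 := by
  obtain ⟨ρ, hρζ, hρ1, hρ⟩ := exists_radius (one_lt_card F) (norm_pos_iff.2 h0) h1
  obtain ⟨m, hm, H⟩ := l.exists_gaussLE_remainder h0 h1 hρζ hρ1 hρ
  intro h
  have h2 := (H ‖ζ‖ hρ.le hρζ.le).norm_tsum_le h0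
  rw [← eval_apply h0 h1, remainder, map_sub, eval_const, h, sub_zero] at h2
  exact absurd hm (not_lt.2 h2)

lemma eval_one_sub (h0 : ζ ≠ 0) (h1 : ‖ζ‖ < 1) :
    eval h0 h1 (1 - const ζ h1.le * zpow (-1)) = 0 := by
  rw [map_sub, map_one, map_mul, eval_const, eval_zpow, zpow_neg_one, mul_inv_cancel₀ h0, sub_self]

lemma eval_ell (h0 : ζ ≠ 0) (h1 : ‖ζ‖ < 1) : eval h0 h1 (l.ell h1) = 0 := by
  rw [ell_eq, map_mul, eval_one_sub, zero_mul]

/-- On circles of radius less than `|ζ|` the factor `1 - ζ / z` is dominated by `-ζ / z`. -/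
lemma gaussLE_of_one_sub_mul (h1 : ‖ζ‖ < 1) {r M : ℝ} (hr0 : 0 < r) (hr : r < ‖ζ‖) {b : BRig C}
    (hb : GaussLE r M ((1 - const ζ h1.le * zpow (-1)) * b)) :
    GaussLE r (M / (‖ζ‖ * r ^ (-1 : ℤ))) b := by
  refine GaussLE.of_mul (a := const ζ h1.le * zpow (-1) - 1) (m := 1) hr0 (hr.trans h1) h1.le ?_ ?_ ?_
  · rw [sub_sub_cancel_left]; exact (GaussLE.one hr0).neg
  · rw [zpow_neg_one, ← div_eq_mul_inv]; exact (one_lt_div hr0).2 hr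
  · have : (const ζ h1.le * zpow (-1) - 1) * b = -((1 - const ζ h1.le * zpow (-1)) * b) := by ring
    rw [this]; exact hb.neg

lemma gaussLE_of_cofactor_mul (h1 : ‖ζ‖ < 1) {r m M : ℝ} (hr0 : 0 < r) (hr1 : r < 1)
    (hm : m < ‖l.seq 0‖) (H : GaussLE r m (l.remainder h1)) {b : BRig C}
    (hb : GaussLE r M (l.cofactor h1 * b)) : GaussLE r (M / ‖l.seq 0‖) b := by
  have h := GaussLE.of_mul (j := 0) (m := m) hr0 hr1 (l.norm_lt h1 0).le ?_ (by simpa) hb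
  · simpa using h
  · have e : (zpow 0 : BRig C) = 1 := rfl
    rw [e, mul_one, ← neg_sub]; exact H.neg

/-- Partial sums of the geometric series for the quotient of `g` by the cofactor, multiplied
by a power of the constant term. -/
def geomPartial (h1 : ‖ζ‖ < 1) (g : BRig C) : ℕ → BRig C
  | 0 => 0
  | N + 1 => const (l.seq 0) (l.norm_lt h1 0).le * geomPartial h1 g N + g * l.remainder h1 ^ N

/-- The telescoping identity `(c - w) ∑_{k<N} c ^ (N - 1 - k) w ^ k = c ^ N - w ^ N`. The factor `c
^ N` is kept because `|c| < 1`, so dividing by `c` would leave the ring. -/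
lemma cofactor_mul_geomPartial (h1 : ‖ζ‖ < 1) (g : BRig C) (N : ℕ) :
    l.cofactor h1 * l.geomPartial h1 g N =
      (const (l.seq 0) (l.norm_lt h1 0).le ^ N - l.remainder h1 ^ N) * g := by
  have hu : l.cofactor h1 = const (l.seq 0) (l.norm_lt h1 0).le - l.remainder h1 := by
    rw [remainder]; ring
  induction N with
  | zero => simp [geomPartial]
  | succ N ih =>
    rw [geomPartial]
    rw [hu] at ih ⊢
    linear_combination const (l.seq 0) (l.norm_lt h1 0).le * ih

end DivisionTower
end Quotient

/-! ### Division by `ℓ` -/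

section Divisibility

variable {F : Type*} [Field F] [Finite F]
variable {C : Type*} [NontriviallyNormedField C] [IsUltrametricDist C] [CompleteSpace C]
variable [Algebra F C] {ζ : C}

namespace DivisionTower

open BRig

variable (l : DivisionTower F ζ)

lemma ell_mul_geomPartial (h1 : ‖ζ‖ < 1) {g h : BRig C}
    (hg : h = (1 - const ζ h1.le * zpow (-1)) * g) (N : ℕ) : l.ell h1 * l.geomPartial h1 g N =
    (const (l.seq 0) (l.norm_lt h1 0).le ^ N - l.remainder h1 ^ N) * h := by
  rw [hg, ell_eq, mul_assoc, cofactor_mul_geomPartial]; ring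

/-- Apply `σ` to `ℓ H = (c ^ N - w ^ N) h` and subtract `z ^ n c ^ ((q - 1) N)` times the original:
the terms with `c ^ (q N)` cancel. What remains is small, so the partial sums satisfy the functional
equation up to a vanishing error. -/
lemma ell_mul_sigma_geomPartial (h1 : ‖ζ‖ < 1) {n : ℕ} {g h : BRig C}
    (hg : h = (1 - const ζ h1.le * zpow (-1)) * g) (hh : sigma F h = zpow (n + 1) * h) (N : ℕ) :
    l.ell h1 * (sigma F (l.geomPartial h1 g N) - zpow n *
      (const (l.seq 0) (l.norm_lt h1 0).le ^ ((Nat.card F - 1) * N) * l.geomPartial h1 g N)) =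
    zpow n * h * (const (l.seq 0) (l.norm_lt h1 0).le ^ ((Nat.card F - 1) * N) *
      l.remainder h1 ^ N - sigma F (l.remainder h1) ^ N) := by
  set c := const (l.seq 0) (l.norm_lt h1 0).le
  have e1 := l.ell_mul_geomPartial h1 hg N
  have e2 := congrArg (sigma F) e1
  rw [map_mul, sigma_ell, map_mul, map_sub, map_pow, map_pow, sigma_const, hh] at e2
  have hz : (zpow (-1) * zpow 1 : BRig C) = 1 := zpow_mul_zpow (-1) 1
  have hz2 : (zpow (-1) * zpow (n + 1) : BRig C) = zpow n := by
    rw [zpow_mul_zpow]; congr 1; ring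
  have hc : (c ^ Nat.card F) ^ N = c ^ ((Nat.card F - 1) * N) * c ^ N := by
    rw [← pow_mul, ← pow_add]
    congr 1
    obtain ⟨k, hk⟩ := Nat.exists_eq_add_of_lt (one_lt_card F)
    rw [hk]; simp only [Nat.add_sub_cancel]; ring
  change zpow 1 * l.ell h1 * sigma F (l.geomPartial h1 g N) =
    ((c ^ Nat.card F) ^ N - sigma F (l.remainder h1) ^ N) * (zpow (n + 1) * h) at e2
  rw [hc] at e2
  linear_combination zpow (-1) * e2 - zpow n * c ^ ((Nat.card F - 1) * N) * e1 -
    l.ell h1 * sigma F (l.geomPartial h1 g N) * hz +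
    (c ^ ((Nat.card F - 1) * N) * c ^ N - sigma F (l.remainder h1) ^ N) * h * hz2

lemma coeff_sigma_sub (h1 : ‖ζ‖ < 1) (n N : ℕ) (H : BRig C) (i : ℤ) :
    (sigma F H - zpow n *
      (const (l.seq 0) (l.norm_lt h1 0).le ^ ((Nat.card F - 1) * N) * H)).coeff i =
    H.coeff i ^ Nat.card F - l.seq 0 ^ ((Nat.card F - 1) * N) * H.coeff (i - n) := by
  rw [coeff_sub, coeff_sigma, coeff_zpow_mul, coeff_const_pow_mul]

/-- If `σ h = z ^ (n + 1) h` and `h` vanishes at `ζ`, then `h` is divisible by `ℓ`. -/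
theorem exists_eq_ell_mul (h0 : ζ ≠ 0) (h1 : ‖ζ‖ < 1) {n : ℕ} {h : BRig C}
    (hh : sigma F h = zpow (n + 1) * h) (hζ : eval h0 h1 h = 0) :
    ∃ f : BRig C, h = l.ell h1 * f ∧ sigma F f = zpow n * f := by
  obtain ⟨g, hg⟩ := exists_eq_one_sub_mul h0 h1 hζ
  obtain ⟨ρ, hρζ, hρ1, hρ⟩ := exists_radius (one_lt_card F) (norm_pos_iff.2 h0) h1
  obtain ⟨m, hm, hrem⟩ := l.exists_gaussLE_remainder h0 h1 hρζ hρ1 hρ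
  have hρ0 : 0 < ρ := (norm_nonneg ζ).trans_lt hρζ
  -- All estimates are made on this circle: both `w` and `σ(w)` are controlled there, and `r < |ζ|`
  -- gives `1 - ζ / z` the dominant term `-ζ / z`.
  set r := ρ ^ Nat.card F with hr
  have hr0 : 0 < r := pow_pos hρ0 _
  have hrρ : r ≤ ρ := (hρ.trans hρζ).le
  have hr1 : r < 1 := hrρ.trans_lt hρ1
  have hl := l.norm_seq_zero_pos h0
  have hlne : l.seq 0 ≠ 0 := norm_pos_iff.1 hl
  have hw := hrem r le_rfl hrρ
  have hσw : GaussLE r (m ^ Nat.card F) (sigma F (l.remainder h1)) :=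
    (hrem ρ hrρ le_rfl).sigma hρ0
  have hm0 : 0 ≤ m := hw.nonneg hr0
  set θ := m / ‖l.seq 0‖ with hθ
  have hθ0 : 0 ≤ θ := by positivity
  have hθ1 : θ < 1 := (div_lt_one hl).2 hm
  have hmθ : m = θ * ‖l.seq 0‖ := by rw [hθ]; field_simp
  have hθlim := tendsto_pow_atTop_nhds_zero_of_lt_one hθ0 hθ1
  obtain ⟨A, hA⟩ := GaussLE.exists_bound (l.ell h1) hr0 hr1
  obtain ⟨B, hB⟩ := GaussLE.exists_bound g hr0 hr1
  obtain ⟨E, hE⟩ := GaussLE.exists_bound h hr0 hr1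
  have hA0 := hA.nonneg hr0
  have hB0 := hB.nonneg hr0
  have hE0 := hE.nonneg hr0
  let H := l.geomPartial h1 g
  -- The coefficients of the honest partial sums `∑_{k<N} g w ^ k / c ^ (k + 1)`.
  let T : ℤ → ℕ → C := fun i N => (H N).coeff i / l.seq 0 ^ N
  set D := B / ‖l.seq 0‖ with hD
  have hT : ∀ i N, ‖T i (N + 1) - T i N‖ ≤ D * r ^ (-i) * θ ^ N := by
    intro i N
    have e : T i (N + 1) - T i N = (g * l.remainder h1 ^ N).coeff i / l.seq 0 ^ (N + 1) := by
      simp only [T, H, geomPartial, coeff_add, coeff_const_mul]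
      field_simp
      ring
    have h2 := (hB.mul hr0 (hw.pow hr0 N)) i
    rw [e, norm_div, norm_pow, div_le_iff₀ (by positivity), zpow_neg]
    rw [← le_div_iff₀ (zpow_pos hr0 i)] at h2
    refine h2.trans (le_of_eq ?_)
    rw [hmθ, hD, mul_pow]
    field_simp
    ring
  choose b hb using fun i => exists_limit_of_norm_sub_le (T i)
    (by positivity : 0 ≤ D * r ^ (-i)) hθ0 hθ1 (hT i)
  have hbT : ∀ i, Tendsto (T i) atTop (𝓝 (b i)) := fun i => by
    rw [tendsto_iff_norm_sub_tendsto_zero]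
    refine squeeze_zero (fun _ => norm_nonneg _) (fun N => (norm_sub_rev _ _).le.trans (hb i N)) ?_
    simpa using hθlim.const_mul (D * r ^ (-i))
  have hbr : ∀ i N, ‖b i - T i N‖ * r ^ i ≤ D * θ ^ N := fun i N => by
    have := mul_le_mul_of_nonneg_right (hb i N) (zpow_nonneg hr0.le i)
    refine this.trans (le_of_eq ?_)
    rw [zpow_neg]; field_simp
  -- the functional equation
  have hbσ : ∀ i, b i ^ Nat.card F = b (i - n) := by
    intro i
    have hlim : Tendsto (fun N => T i N ^ Nat.card F - T (i - n) N) atTop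
        (𝓝 (b i ^ Nat.card F - b (i - n))) := ((hbT i).pow _).sub (hbT (i - n))
    refine sub_eq_zero.1 (tendsto_nhds_unique hlim ?_)
    set D' := r ^ (n : ℤ) * E / (‖ζ‖ * r ^ (-1 : ℤ)) / ‖l.seq 0‖ with hD'
    have hD0 : 0 ≤ D' := by positivity
    rw [tendsto_zero_iff_norm_tendsto_zero]
    refine squeeze_zero (fun _ => norm_nonneg _) (fun N => ?_)
      (by simpa using hθlim.const_mul (D' * r ^ (-i)))
    set t := (Nat.card F - 1) * N with ht
    have htN : t + N = Nat.card F * N := by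
      obtain ⟨k, hk⟩ := Nat.exists_eq_add_of_lt (one_lt_card F)
      rw [ht, hk]; simp only [Nat.add_sub_cancel]; ring
    -- Relative to `|c| ^ (q N)` this error has size `θ ^ N`. Dividing by `ℓ`, whose two factors
    -- have dominant terms on this circle, costs only a constant, absorbed in `D'`.
    have h2 : GaussLE r (‖l.seq 0‖ ^ t * m ^ N)
        (const (l.seq 0) (l.norm_lt h1 0).le ^ t * l.remainder h1 ^ N -
          sigma F (l.remainder h1) ^ N) := by
      refine (((GaussLE.const (l.seq 0) (l.norm_lt h1 0).le).pow hr0 t).mul hr0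
        (hw.pow hr0 N)).sub hr0 ((hσw.pow hr0 N).mono ?_)
      rw [← pow_mul, ← htN, pow_add]
      exact mul_le_mul_of_nonneg_right (pow_le_pow_left₀ hm0 hm.le _) (by positivity)
    have h3 := ((GaussLE.zpow hr0 n).mul hr0 hE).mul hr0 h2
    rw [← l.ell_mul_sigma_geomPartial h1 hg hh N, ell_eq, mul_assoc (1 - _)] at h3
    have h4 := l.gaussLE_of_cofactor_mul h1 hr0 hr1 hm hw
      (gaussLE_of_one_sub_mul h1 hr0 hρ h3) i
    rw [l.coeff_sigma_sub h1] at h4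
    have e : T i N ^ Nat.card F - T (i - n) N = ((H N).coeff i ^ Nat.card F -
        l.seq 0 ^ t * (H N).coeff (i - n)) / l.seq 0 ^ (Nat.card F * N) := by
      simp only [T]
      rw [← htN, div_pow, ← pow_mul, mul_comm N, ← htN, pow_add]
      field_simp
    rw [← le_div_iff₀ (zpow_pos hr0 i)] at h4
    rw [e, norm_div, norm_pow, div_le_iff₀ (by positivity)]
    refine h4.trans (le_of_eq ?_)
    rw [← htN, pow_add, hmθ, hD', mul_pow]
    ring
  -- The limit is so far only bounded on one circle. The case `N = 0`, where the partial sum is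
  -- empty, is that bound.
  obtain ⟨f, hf⟩ := exists_coeff_eq_of_pow_eq (one_lt_card F) b n hbσ (M := D) hr0 hr1 fun i => by
    simpa [T, H, geomPartial] using hbr i 0
  refine ⟨f, ?_, ?_⟩
  · have h2 : ∀ N, GaussLE r (D * m ^ N)
        (const (l.seq 0) (l.norm_lt h1 0).le ^ N * f - H N) := by
      intro N i
      rw [coeff_sub, coeff_const_pow_mul, hf]
      have e : l.seq 0 ^ N * b i - (H N).coeff i = l.seq 0 ^ N * (b i - T i N) := by
        simp only [T]; field_simp
      rw [e, norm_mul, norm_pow, hmθ, mul_pow, mul_assoc]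
      calc _ ≤ ‖l.seq 0‖ ^ N * (D * θ ^ N) :=
            mul_le_mul_of_nonneg_left (hbr i N) (by positivity)
        _ = _ := by ring
    -- Multiplied by `c ^ N`, the difference `ℓ f - h` is `ℓ (c ^ N f - H_N) - w ^ N h`, of size `m
    -- ^ N`. Since `m < |c|`, letting `N` grow gives `ℓ f = h`.
    have h3 : ∀ N, GaussLE r (max (A * D) E * m ^ N)
        (const (l.seq 0) (l.norm_lt h1 0).le ^ N * (l.ell h1 * f - h)) := by
      intro N
      have e := l.ell_mul_geomPartial h1 hg N
      have e2 : const (l.seq 0) (l.norm_lt h1 0).le ^ N * (l.ell h1 * f - h) =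
          l.ell h1 * (const (l.seq 0) (l.norm_lt h1 0).le ^ N * f - H N) -
            l.remainder h1 ^ N * h := by
        linear_combination e
      rw [e2]
      refine ((hA.mul hr0 (h2 N)).mono ?_).sub hr0 (((hw.pow hr0 N).mul hr0 hE).mono ?_)
      · rw [← mul_assoc]; exact mul_le_mul_of_nonneg_right (le_max_left _ _) (by positivity)
      · rw [mul_comm]; exact mul_le_mul_of_nonneg_right (le_max_right _ _) (by positivity)
    have h4 : GaussLE r 0 (l.ell h1 * f - h) := by
      intro i
      refine ge_of_tendsto' (by simpa using hθlim.const_mul (max (A * D) E)) fun N => ?_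
      have h5 := h3 N i
      rw [coeff_const_pow_mul, norm_mul, norm_pow, hmθ, mul_pow] at h5
      have hp : 0 < ‖l.seq 0‖ ^ N := by positivity
      refine le_of_mul_le_mul_left ?_ hp
      calc _ = ‖l.seq 0‖ ^ N * ‖(l.ell h1 * f - h).coeff i‖ * r ^ i := by ring
        _ ≤ _ := h5
        _ = _ := by ring
    exact (sub_eq_zero.1 (h4.eq_zero hr0)).symm
  · ext i
    rw [coeff_sigma, coeff_zpow_mul, hf, hf, hbσ]

end DivisionTower
end Divisibility

/-! ### Values at `ζ` of solutions of `σ f = z f` -/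

section Surjectivity

/-- A monic polynomial with constant coefficient `a` has a root of norm at most `|a| ^ (1 / d)`,
where `d` is its degree. -/
lemma exists_root_norm_pow_le {L : Type*} [NormedField L] [IsAlgClosed L] {p : Polynomial L}
    (hp : p.Monic) (hd : p.natDegree ≠ 0) :
    ∃ w, p.eval w = 0 ∧ ‖w‖ ^ p.natDegree ≤ ‖p.coeff 0‖ := by
  classical
  have hs := IsAlgClosed.splits p
  have hcard : Multiset.card p.roots = p.natDegree := hs.natDegree_eq_card_roots.symm
  have hne : p.roots.toFinset.Nonempty := by
    rw [Multiset.toFinset_nonempty, ← Multiset.card_pos, hcard]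
    omega
  -- The norms of the roots multiply to `|p(0)|`, so the smallest root satisfies the bound.
  obtain ⟨w, hw, hmin⟩ := p.roots.toFinset.exists_min_image (fun x => ‖x‖₊) hne
  rw [Multiset.mem_toFinset] at hw
  refine ⟨w, (Polynomial.mem_roots'.1 hw).2, ?_⟩
  have h := Multiset.pow_card_le_prod (s := p.roots.map fun x => ‖x‖₊) (a := ‖w‖₊) (by
    intro x hx
    obtain ⟨y, hy, rfl⟩ := Multiset.mem_map.1 hx
    exact hmin y (Multiset.mem_toFinset.2 hy))
  have h2 : (p.roots.map fun x => ‖x‖₊).prod = ‖p.roots.prod‖₊ :=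
    (map_multiset_prod (nnnormHom (α := L)) p.roots).symm
  rw [Multiset.card_map, hcard, h2] at h
  rw [hs.coeff_zero_eq_prod_roots_of_monic hp, norm_mul, norm_pow, norm_neg, norm_one, one_pow,
    one_mul]
  exact_mod_cast h

variable (F : Type*) [Field F] [Finite F]
variable {C : Type*} [NontriviallyNormedField C] [IsUltrametricDist C] [CompleteSpace C]
variable [Algebra F C] [IsAlgClosed C] {ζ : C}

variable (C) in
/-- The `q`-Frobenius as an automorphism. -/
def frobAut : RingAut C := RingEquiv.ofBijective (frob F C)
  ⟨(frob F C).injective, fun x => IsAlgClosed.exists_pow_nat_eq x Nat.card_pos⟩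

lemma frobAut_pow_apply (n : ℕ) (x : C) : (frobAut F C ^ (n : ℤ)) x = x ^ Nat.card F ^ n := by
  rw [zpow_natCast]
  induction n with
  | zero => simp
  | succ n ih =>
    rw [pow_succ', RingAut.mul_apply, ih, pow_succ, pow_mul]
    rfl

lemma frobAut_zpow_apply_pow (i : ℤ) (x : C) :
    (frobAut F C ^ i) x ^ Nat.card F = (frobAut F C ^ (i + 1)) x := by
  rw [add_comm, zpow_add, zpow_one, RingAut.mul_apply]
  rfl

lemma norm_frobAut_le_one {x : C} (hx : ‖x‖ ≤ 1) (i : ℤ) : ‖(frobAut F C ^ i) x‖ ≤ 1 := by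
  obtain ⟨n, rfl | rfl⟩ := i.eq_nat_or_neg
  · rw [frobAut_pow_apply, norm_pow]; exact pow_le_one₀ (norm_nonneg _) hx
  · by_contra! h
    have h2 : (frobAut F C ^ (n : ℤ)) ((frobAut F C ^ (-(n : ℤ))) x) = x := by
      rw [← RingAut.mul_apply, ← zpow_add, add_neg_cancel, zpow_zero, RingAut.one_apply]
    rw [frobAut_pow_apply] at h2
    have h3 := one_lt_pow₀ h (pow_ne_zero n (one_lt_card F).ne_bot)
    rw [← norm_pow, h2] at h3
    exact absurd hx (not_le.2 h3)

namespace BRig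

/-- For `|x| < ρ < 1` the terms on the circle of radius `ρ` are at most `1`: at `i = -n` because `q
^ n ≥ n`. The functional equation does the rest. -/
lemma exists_eigen {x : C} (hx : ‖x‖ < 1) :
    ∃ f : BRig C, ∀ i, f.coeff i = (frobAut F C ^ (-i)) x := by
  obtain ⟨ρ, hρ, hρ1⟩ := exists_between hx
  have hρ0 : 0 < ρ := (norm_nonneg x).trans_lt hρ
  refine exists_coeff_eq_of_pow_eq (one_lt_card F) _ 1 (fun i => ?_) hρ0 hρ1 (M := 1) fun i => ?_
  · rw [frobAut_zpow_apply_pow]; congr 2; push_cast; ring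
  · obtain ⟨n, rfl | rfl⟩ := i.eq_nat_or_neg
    · exact mul_le_one₀ (norm_frobAut_le_one F hx.le _) (by positivity)
        (by rw [zpow_natCast]; exact pow_le_one₀ hρ0.le hρ1.le)
    · rw [neg_neg, frobAut_pow_apply, norm_pow, zpow_neg, zpow_natCast, ← div_eq_mul_inv,
        div_le_one (by positivity)]
      calc _ ≤ ρ ^ Nat.card F ^ n := pow_le_pow_left₀ (norm_nonneg _) hρ.le _
        _ ≤ ρ ^ n := pow_le_pow_of_le_one hρ0.le hρ1.le (Nat.lt_pow_self (one_lt_card F)).le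

/-- The series `∑ x ^ (q ^ (-i)) z ^ i`. -/
def eigen {x : C} (hx : ‖x‖ < 1) : BRig C := (exists_eigen F hx).choose

lemma coeff_eigen {x : C} (hx : ‖x‖ < 1) (i : ℤ) :
    (eigen F hx).coeff i = (frobAut F C ^ (-i)) x := (exists_eigen F hx).choose_spec i

lemma sigma_eigen {x : C} (hx : ‖x‖ < 1) : sigma F (eigen F hx) = zpow 1 * eigen F hx := by
  ext i
  rw [coeff_sigma, coeff_zpow_mul, coeff_eigen, coeff_eigen, frobAut_zpow_apply_pow]
  congr 2; ring

/-- The map `x ↦ e(x)` is additive and carries the Frobenius to multiplication by `z`. -/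
lemma eigen_add_pow {x y d : C} (hx : ‖x‖ < 1) (hy : ‖y‖ < 1) (hd : ‖d‖ < 1)
    (h : d = x + y ^ Nat.card F) : eigen F hd = eigen F hx + zpow 1 * eigen F hy := by
  ext i
  rw [coeff_add, coeff_zpow_mul, coeff_eigen, coeff_eigen, coeff_eigen, h, map_add]
  congr 1
  have e : -(i - 1) = -i + 1 := by ring
  rw [e, zpow_add, zpow_one, RingAut.mul_apply]
  rfl

variable {F} in
-- The exponent of `|ζ|` is at least `2 q ^ j - (2 + j) ≥ j`, as `q ^ j > j`. Starting at `-2`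
-- matters: from `-1` the analogous exponent `q ^ j - (1 + j)` is `0` for `q = 2`, `j = 1`.
lemma norm_coeff_eigen_mul_le (h0 : ζ ≠ 0) (h1 : ‖ζ‖ < 1) {x : C} (hx : ‖x‖ < 1)
    (hx2 : ‖x‖ ^ Nat.card F ^ 2 ≤ ‖ζ‖ ^ 2) (j : ℕ) :
    ‖(eigen F hx).coeff (-(2 + j : ℕ)) * ζ ^ (-(2 + j : ℕ) : ℤ)‖ ≤ ‖ζ‖ ^ j := by
  have hζ := norm_pos_iff.2 h0
  rw [coeff_eigen, neg_neg, frobAut_pow_apply, norm_mul, norm_pow, norm_zpow, zpow_neg,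
    zpow_natCast, ← div_eq_mul_inv, div_le_iff₀ (by positivity), pow_add (Nat.card F), pow_mul]
  refine (pow_le_pow_left₀ (by positivity) hx2 _).trans ?_
  rw [← pow_mul, ← pow_add]
  refine pow_le_pow_of_le_one hζ.le h1.le ?_
  have := Nat.lt_pow_self (one_lt_card F) (n := j)
  omega

variable {F} in
lemma norm_eval_eigen_le (h0 : ζ ≠ 0) (h1 : ‖ζ‖ < 1) {x : C} (hx : ‖x‖ < 1)
    (hx2 : ‖x‖ ^ Nat.card F ^ 2 ≤ ‖ζ‖ ^ 2) : ‖eval h0 h1 (eigen F hx)‖ ≤ ‖ζ‖ ^ (-2 : ℤ) := by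
  have hζ := norm_pos_iff.2 h0
  rw [eval_apply]
  refine IsUltrametricDist.norm_tsum_le_of_forall_le_of_nonneg (by positivity) fun i => ?_
  rcases le_total (-2) i with hi | hi
  · rw [norm_mul, norm_zpow]
    exact (mul_le_of_le_one_left (by positivity) (norm_coeff_le _ _)).trans
      (zpow_le_zpow_right_of_le_one₀ hζ h1.le hi)
  · obtain ⟨j, rfl⟩ : ∃ j : ℕ, i = -(2 + j : ℕ) := ⟨(-i - 2).toNat, by omega⟩
    refine (norm_coeff_eigen_mul_le h0 h1 hx hx2 j).trans ((pow_le_one₀ hζ.le h1.le).trans ?_)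
    exact one_le_zpow_of_nonpos₀ hζ h1.le (by norm_num)

/-- The equation for the approximations. -/
lemma exists_root_eq (ζ c : C) : ∃ w : C, ‖w‖ ^ Nat.card F ^ 4 ≤ ‖c‖ ∧
    w ^ Nat.card F ^ 4 + ζ * w ^ Nat.card F ^ 3 + ζ ^ 2 * w ^ Nat.card F ^ 2 +
      ζ ^ 3 * w ^ Nat.card F + ζ ^ 4 * w = c := by
  set q := Nat.card F with hq
  have h1 : 1 < q := one_lt_card F
  have e1 : q ^ 3 < q ^ 4 := Nat.pow_lt_pow_right h1 (by norm_num)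
  have e2 : q ^ 2 < q ^ 4 := Nat.pow_lt_pow_right h1 (by norm_num)
  have e3 : q < q ^ 4 := by
    calc q = q ^ 1 := (pow_one q).symm
      _ < q ^ 4 := Nat.pow_lt_pow_right h1 (by norm_num)
  let r : Polynomial C := Polynomial.C ζ * Polynomial.X ^ q ^ 3 +
    Polynomial.C (ζ ^ 2) * Polynomial.X ^ q ^ 2 + Polynomial.C (ζ ^ 3) * Polynomial.X ^ q +
    Polynomial.C (ζ ^ 4) * Polynomial.X ^ 1 - Polynomial.C c
  have hlt : ∀ (a : C) (n : ℕ), n < q ^ 4 →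
      (Polynomial.C a * Polynomial.X ^ n).degree < ((q ^ 4 : ℕ) : WithBot ℕ) := fun a n hn =>
    (Polynomial.degree_C_mul_X_pow_le n a).trans_lt (by exact_mod_cast hn)
  have hr : r.degree < ((q ^ 4 : ℕ) : WithBot ℕ) := by
    refine (Polynomial.degree_sub_le _ _).trans_lt (max_lt ?_
      (Polynomial.degree_C_le.trans_lt (by exact_mod_cast (by omega : 0 < q ^ 4))))
    refine (Polynomial.degree_add_le _ _).trans_lt (max_lt ?_ (hlt _ _ (by omega)))
    refine (Polynomial.degree_add_le _ _).trans_lt (max_lt ?_ (hlt _ _ e3))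
    exact (Polynomial.degree_add_le _ _).trans_lt (max_lt (hlt _ _ e1) (hlt _ _ e2))
  have hmon : (Polynomial.X ^ q ^ 4 + r).Monic := Polynomial.monic_X_pow_add hr
  have hdeg : (Polynomial.X ^ q ^ 4 + r).natDegree = q ^ 4 := by
    apply Polynomial.natDegree_eq_of_degree_eq_some
    rw [Polynomial.degree_add_eq_left_of_degree_lt (by rwa [Polynomial.degree_X_pow]),
      Polynomial.degree_X_pow]
  obtain ⟨w, hw, hw2⟩ := exists_root_norm_pow_le hmon (by omega)
  have hz : ∀ n, q ^ n ≠ 0 := fun n => pow_ne_zero n (by omega)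
  refine ⟨w, ?_, ?_⟩
  · rw [hdeg] at hw2
    refine hw2.trans (le_of_eq ?_)
    have hq0 : q ≠ 0 := by omega
    rw [Polynomial.coeff_zero_eq_eval_zero]
    simp [r, hq0]
  · simp only [r, Polynomial.eval_add, Polynomial.eval_sub, Polynomial.eval_mul,
      Polynomial.eval_pow, Polynomial.eval_X, Polynomial.eval_C] at hw
    linear_combination hw

/-- Only the terms with `|i| ≤ 2` are solved for. With `x = w ^ (q ^ 2)` and after multiplication by
`ζ ^ 2` they form a polynomial in `w`. A small root `w` gives the bound on `x` that keeps the
remaining terms at most `|ζ|`. -/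
lemma exists_eval_eigen_approx (h0 : ζ ≠ 0) (h1 : ‖ζ‖ < 1) {c : C} (hc : ‖c‖ ≤ 1) :
    ∃ (x : C) (hx : ‖x‖ < 1), ‖x‖ ^ Nat.card F ^ 2 ≤ ‖ζ‖ ^ 2 ∧
      ‖c - eval h0 h1 (eigen F hx)‖ ≤ ‖ζ‖ := by
  have hζ := norm_pos_iff.2 h0
  obtain ⟨w, hw, hw2⟩ := exists_root_eq F ζ (ζ ^ 2 * c)
  have hx2 : ‖w ^ Nat.card F ^ 2‖ ^ Nat.card F ^ 2 ≤ ‖ζ‖ ^ 2 := by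
    rw [norm_pow, ← pow_mul, ← pow_add]
    refine hw.trans ?_
    rw [norm_mul, norm_pow]
    exact mul_le_of_le_one_right (by positivity) hc
  have hx : ‖w ^ Nat.card F ^ 2‖ < 1 := by
    by_contra! h
    have h3 := (one_le_pow₀ h (n := Nat.card F ^ 2)).trans hx2
    exact absurd h3 (not_le.2 (pow_lt_one₀ hζ.le h1 two_ne_zero))
  refine ⟨_, hx, hx2, ?_⟩
  have hs := (eigen F hx).summable_weight h0 h1
  have hcoeff : ∀ (i : ℤ) (n : ℕ), i + n = 2 →
      (eigen F hx).coeff i = w ^ Nat.card F ^ n := by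
    intro i n hi
    rw [coeff_eigen, ← frobAut_pow_apply F 2, ← RingAut.mul_apply, ← zpow_add,
      ← frobAut_pow_apply F n]
    congr 2; push_cast; omega
  have hset : Finset.Icc (-2 : ℤ) 2 = {-2, -1, 0, 1, 2} := by decide
  have hsum : ∑ i ∈ Finset.Icc (-2 : ℤ) 2, (eigen F hx).coeff i * ζ ^ i = c := by
    rw [hset, Finset.sum_insert (by decide), Finset.sum_insert (by decide),
      Finset.sum_insert (by decide), Finset.sum_insert (by decide), Finset.sum_singleton]
    rw [hcoeff (-2) 4 (by norm_num), hcoeff (-1) 3 (by norm_num), hcoeff 0 2 (by norm_num),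
      hcoeff 1 1 (by norm_num), hcoeff 2 0 (by norm_num)]
    have e1 : ζ ^ (-2 : ℤ) * ζ ^ 2 = 1 := by
      rw [← zpow_natCast, ← zpow_add₀ h0]; simp
    have e2 : ζ ^ (-1 : ℤ) * ζ = 1 := by rw [zpow_neg_one, inv_mul_cancel₀ h0]
    have e3 : ζ ^ (2 : ℤ) = ζ ^ 2 := zpow_natCast ζ 2
    have e4 : ζ ^ 2 ≠ 0 := pow_ne_zero 2 h0
    apply mul_left_cancel₀ e4
    rw [e3, pow_one, pow_zero, pow_one, zpow_zero, zpow_one]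
    linear_combination hw2 + w ^ Nat.card F ^ 4 * e1 + w ^ Nat.card F ^ 3 * ζ * e2
  rw [eval_apply, ← hs.sum_add_tsum_subtype_compl (Finset.Icc (-2) 2), hsum, sub_add_cancel_left,
    norm_neg]
  refine IsUltrametricDist.norm_tsum_le_of_forall_le_of_nonneg hζ.le ?_
  rintro ⟨i, hi⟩
  rw [Finset.mem_Icc, not_and_or, not_le, not_le] at hi
  rcases hi with hi | hi
  · obtain ⟨j, rfl⟩ : ∃ j : ℕ, i = -(2 + j : ℕ) := ⟨(-i - 2).toNat, by omega⟩
    refine (norm_coeff_eigen_mul_le h0 h1 hx hx2 j).trans ?_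
    exact pow_le_of_le_one hζ.le h1.le (by omega)
  · rw [norm_mul, norm_zpow]
    refine (mul_le_of_le_one_left (by positivity) (norm_coeff_le _ _)).trans ?_
    exact (zpow_le_zpow_right_of_le_one₀ hζ h1.le (by omega : 1 ≤ i)).trans_eq (zpow_one _)

lemma exists_eval_eq_of_norm_le_one (h0 : ζ ≠ 0) (h1 : ‖ζ‖ < 1) {c : C} (hc : ‖c‖ ≤ 1) :
    ∃ f : BRig C, sigma F f = zpow 1 * f ∧ eval h0 h1 f = c := by
  have hζ := norm_pos_iff.2 h0
  have hQ : Nat.card F ^ 2 ≠ 0 := pow_ne_zero 2 (one_lt_card F).ne_bot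
  choose X hX hX2 hXc using fun (c : C) (hc : ‖c‖ ≤ 1) => exists_eval_eigen_approx F h0 h1 hc
  -- Successive errors divided by `ζ`; the approximation keeps them integral, so the procedure can
  -- be repeated.
  let cs : ℕ → {c : C // ‖c‖ ≤ 1} := fun n => Nat.rec ⟨c, hc⟩
    (fun _ c => ⟨(c.1 - eval h0 h1 (eigen F (hX c.1 c.2))) / ζ, by
      rw [norm_div]; exact (div_le_one hζ).2 (hXc c.1 c.2)⟩) n
  let x : ℕ → C := fun n => X (cs n).1 (cs n).2
  have hx : ∀ n, ‖x n‖ < 1 := fun n => hX _ _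
  have hx2 : ∀ n, ‖x n‖ ^ Nat.card F ^ 2 ≤ ‖ζ‖ ^ 2 := fun n => hX2 _ _
  have hcs : ∀ n, (cs n).1 = eval h0 h1 (eigen F (hx n)) + ζ * (cs (n + 1)).1 := fun n => by
    change (cs n).1 = eval h0 h1 (eigen F (hx n)) +
      ζ * (((cs n).1 - eval h0 h1 (eigen F (hx n))) / ζ)
    field_simp
    ring
  -- A bound below `1` common to all `x_n`. It makes the series for `d n` converge and passes to its
  -- sums.
  obtain ⟨r, hr0, hr⟩ : ∃ r : ℝ, 0 ≤ r ∧ r ^ Nat.card F ^ 2 = ‖ζ‖ ^ 2 :=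
    ⟨(‖ζ‖ ^ 2) ^ (((Nat.card F ^ 2 : ℕ) : ℝ)⁻¹), by positivity,
      Real.rpow_inv_natCast_pow (by positivity) hQ⟩
  have hr1 : r < 1 := by
    by_contra! h
    have h3 := one_le_pow₀ h (n := Nat.card F ^ 2)
    rw [hr] at h3
    exact absurd h3 (not_le.2 (pow_lt_one₀ hζ.le h1 two_ne_zero))
  have hxr : ∀ n, ‖x n‖ ≤ r := fun n =>
    le_of_pow_le_pow_left₀ hQ hr0 ((hx2 n).trans_eq hr.symm)
  have hterm : ∀ n j, ‖x (n + j) ^ Nat.card F ^ j‖ ≤ r ^ j := fun n j => by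
    rw [norm_pow]
    exact (pow_le_pow_left₀ (norm_nonneg _) (hxr _) _).trans
      (pow_le_pow_of_le_one hr0 hr1.le (Nat.lt_pow_self (one_lt_card F)).le)
  have hterm2 : ∀ n j, ‖x (n + j) ^ Nat.card F ^ j‖ ≤ r := fun n j => by
    rw [norm_pow]
    exact (pow_le_of_le_one (norm_nonneg _) (hx _).le
      (pow_ne_zero _ (one_lt_card F).ne_bot)).trans (hxr _)
  have hsum : ∀ n, Summable fun j => x (n + j) ^ Nat.card F ^ j := fun n => by
    apply NonarchimedeanAddGroup.summable_of_tendsto_cofinite_zero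
    rw [Nat.cofinite_eq_atTop, tendsto_zero_iff_norm_tendsto_zero]
    exact squeeze_zero (fun _ => norm_nonneg _) (hterm n)
      (tendsto_pow_atTop_nhds_zero_of_lt_one hr0 hr1)
  let d : ℕ → C := fun n => ∑' j, x (n + j) ^ Nat.card F ^ j
  have hdr : ∀ n, ‖d n‖ ≤ r := fun n =>
    IsUltrametricDist.norm_tsum_le_of_forall_le_of_nonneg hr0 (hterm2 n)
  have hd : ∀ n, ‖d n‖ < 1 := fun n => (hdr n).trans_lt hr1
  have hd2 : ∀ n, ‖d n‖ ^ Nat.card F ^ 2 ≤ ‖ζ‖ ^ 2 := fun n =>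
    (pow_le_pow_left₀ (norm_nonneg _) (hdr n) _).trans_eq hr
  have hdrec : ∀ n, d n = x n + d (n + 1) ^ Nat.card F := fun n => by
    have e : d (n + 1) ^ Nat.card F = ∑' j, x (n + (j + 1)) ^ Nat.card F ^ (j + 1) := by
      refine ((hsum (n + 1)).map_tsum (frob F C) (continuous_frob F)).trans (tsum_congr fun j => ?_)
      rw [frob_apply, ← pow_mul, pow_succ, add_assoc, add_comm 1 j]
    rw [e]
    simpa using (hsum n).tsum_eq_zero_add
  -- Comparing the recursions of `cs` and `d` avoids evaluating an infinite sum of series: the error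
  -- satisfies `e 0 = ζ ^ n e n` with `e n` bounded, hence vanishes.
  let e : ℕ → C := fun n => (cs n).1 - eval h0 h1 (eigen F (hd n))
  have he : ∀ n, e n = ζ * e (n + 1) := fun n => by
    simp only [e]
    rw [eigen_add_pow F (hx n) (hd (n + 1)) (hd n) (hdrec n), map_add, map_mul, eval_zpow,
      zpow_one, hcs n]
    ring
  have he0 : ∀ n, e 0 = ζ ^ n * e n := fun n => by
    induction n with
    | zero => simp
    | succ n ih => rw [ih, he n, pow_succ, mul_assoc]
  have heb : ∀ n, ‖e n‖ ≤ max 1 (‖ζ‖ ^ (-2 : ℤ)) := fun n => by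
    simp only [e]
    rw [sub_eq_add_neg]
    refine (IsUltrametricDist.norm_add_le_max _ _).trans (max_le_max (cs n).2 ?_)
    rw [norm_neg]
    exact norm_eval_eigen_le h0 h1 (hd n) (hd2 n)
  have hzero : e 0 = 0 := by
    rw [← norm_le_zero_iff]
    have hlim := (tendsto_pow_atTop_nhds_zero_of_lt_one hζ.le h1).mul_const
      (max 1 (‖ζ‖ ^ (-2 : ℤ)))
    rw [zero_mul] at hlim
    refine ge_of_tendsto' hlim fun n => ?_
    rw [he0 n, norm_mul, norm_pow]
    exact mul_le_mul_of_nonneg_left (heb n) (by positivity)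
  exact ⟨eigen F (hd 0), sigma_eigen F (hd 0), (sub_eq_zero.1 hzero).symm⟩

/-- The series with `σ f = z f` take every value at `ζ`. -/
theorem exists_eval_eq (h0 : ζ ≠ 0) (h1 : ‖ζ‖ < 1) (c : C) :
    ∃ f : BRig C, sigma F f = zpow 1 * f ∧ eval h0 h1 f = c := by
  have hlim : Tendsto (fun n : ℕ => ‖ζ ^ n * c‖) atTop (𝓝 0) := by
    simp_rw [norm_mul, norm_pow]
    simpa using (tendsto_pow_atTop_nhds_zero_of_lt_one (norm_nonneg ζ) h1).mul_const ‖c‖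
  -- Multiplication by `z ^ (-n)` commutes with the equation and scales the value by `ζ ^ (-n)`, so
  -- integral values suffice.
  obtain ⟨n, hn⟩ := (hlim.eventually_le_const one_pos).exists
  obtain ⟨f, hf, hfc⟩ := exists_eval_eq_of_norm_le_one F h0 h1 hn
  refine ⟨zpow (-n) * f, ?_, ?_⟩
  · rw [map_mul, sigma_zpow, hf]; ring
  · rw [map_mul, eval_zpow, hfc, zpow_neg, zpow_natCast, inv_mul_cancel_left₀ (pow_ne_zero n h0)]

/-- The series with `σ f = z ^ n f`, `n ≥ 1`, take every value at `ζ`. -/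
theorem exists_eval_eq_pow (h0 : ζ ≠ 0) (h1 : ‖ζ‖ < 1) (n : ℕ) (c : C) :
    ∃ f : BRig C, sigma F f = zpow 1 ^ (n + 1) * f ∧ eval h0 h1 f = c := by
  obtain ⟨f, hf, hfc⟩ := exists_eval_eq F h0 h1 c
  obtain ⟨g, hg, hgc⟩ := exists_eval_eq F h0 h1 1
  refine ⟨g ^ n * f, ?_, ?_⟩
  · rw [map_mul, map_pow, hf, hg]; ring
  · rw [map_mul, map_pow, hfc, hgc, one_pow, one_mul]

end BRig
end Surjectivity

/-! ### The completion of an algebraic closure is algebraically closed -/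

section AlgebraicallyClosed

open Polynomial in
/-- A complete nonarchimedean field with a dense algebraically closed subfield is algebraically
closed. -/
theorem isAlgClosed_of_denseRange {K L : Type*} [Field K] [NontriviallyNormedField L]
    [CompleteSpace L] [IsUltrametricDist L] [Algebra K L]
    (hi : DenseRange (algebraMap K L)) [IsAlgClosed K] : IsAlgClosed L := by
  apply IsAlgClosed.of_exists_root
  intro f fmon firr
  have fnatdeg0 : f.natDegree ≠ 0 := (Irreducible.natDegree_pos firr).ne'
  let E := f.SplittingField
  let : NormedField E := spectralNorm.normedField L E
  let : NormedAlgebra L E := spectralNorm.normedAlgebra L E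
  have hdeg : (f.map (algebraMap L E)).degree ≠ 0 := by
    simpa using degree_ne_of_natDegree_ne fnatdeg0
  let a := rootOfSplits (SplittingField.splits f) hdeg
  have fa0 : f.aeval a = 0 := by
    rw [← eval_map_algebraMap]
    exact eval_rootOfSplits (Polynomial.SplittingField.splits f) hdeg
  have hclosed : IsClosed (Set.range (algebraMap L E)) :=
    (algebraMap_isometry L E).isClosedEmbedding.isClosed_range
  have ha : a ∈ closure (Set.range (algebraMap L E)) := by
    rw [Metric.mem_closure_iff]
    intro δ δpos
    -- Chosen so that continuity of roots puts a root of the approximating `g` within `δ` of `a`.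
    -- Since `g` splits over `K`, that root lies in `L`, which is complete and hence closed in `E`.
    have hε : (δ / (max ‖a‖ 1)) ^ f.natDegree / (f.natDegree + 1) > 0 := by positivity
    obtain ⟨g, gmon, gdeg, gcoeff⟩ :=
      exists_monic_and_natDegree_eq_and_norm_map_algebraMap_coeff_sub_lt hi fmon hε
    obtain ⟨b, hb, hab⟩ := exists_aroots_norm_sub_lt_of_norm_coeff_sub_lt
      hε fa0 fmon (gmon.map _) (gdeg ▸ (g.natDegree_map _)) gcoeff
      (by simpa [Polynomial.map_map] using (IsAlgClosed.splits g).map ((algebraMap L E).comp _))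
    have hab : ‖a - b‖ < δ := by
      rw [← Real.rpow_natCast, ← mul_comm_div, div_self, one_mul,
          ← Real.rpow_mul (div_pos δpos (by positivity)).le, mul_inv_cancel₀] at hab
      · simpa [mul_assoc, div_mul_cancel₀ _ (by positivity : (max ‖a‖ 1) > 0).ne'] using hab
      · simp [fnatdeg0]
      · positivity
    rw [Polynomial.aroots_def, Splits.roots_map ((IsAlgClosed.splits g).map _),
      Multiset.mem_map] at hb
    obtain ⟨y, -, hy⟩ := hb
    exact ⟨b, ⟨y, hy⟩, by rwa [dist_eq_norm]⟩
  rw [hclosed.closure_eq] at ha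
  obtain ⟨y, hy⟩ := ha
  refine ⟨y, (algebraMap L E).injective ?_⟩
  rw [← Polynomial.aeval_algebraMap_apply_eq_algebraMap_eval, hy, fa0, map_zero]

instance Kbar.isAlgClosed (K : Type*) [NontriviallyNormedField K] [IsUltrametricDist K]
    [CompleteSpace K] : IsAlgClosed (Kbar K) :=
  letI : Algebra (AlgCl K) (Kbar K) := (Kbar.ofAlgCl K).toAlgebra
  isAlgClosed_of_denseRange (K := AlgCl K) (L := Kbar K) UniformSpace.Completion.denseRange_coe

end AlgebraicallyClosed

/-! ### Exactness of the sequence -/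

section Exactness

variable {F : Type*} [Field F] [Finite F]
variable {C : Type*} [NontriviallyNormedField C] [IsUltrametricDist C] [CompleteSpace C]
variable [Algebra F C] {ζ : C}

namespace BRig

lemma zpow_one_pow (n : ℕ) : (zpow 1 ^ n : BRig C) = zpow n := by
  induction n with
  | zero => rfl
  | succ n ih => rw [pow_succ, ih, zpow_mul_zpow, Nat.cast_succ]

lemma isUnit_zpow (n : ℤ) : IsUnit (zpow n : BRig C) :=
  IsUnit.of_mul_eq_one (zpow (-n)) (by rw [zpow_mul_zpow, add_neg_cancel]; rfl)

end BRig

namespace DivisionTower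

open BRig

variable (l : DivisionTower F ζ) (h0 : ζ ≠ 0) (h1 : ‖ζ‖ < 1)

/-- The expansion of `ℓ` at `z = ζ` has a simple zero. -/
lemma taylor_ell_associated : Associated PowerSeries.X (taylor h0 h1 (l.ell h1)) := by
  have hz : (zpow 1 * zpow (-1) : BRig C) = 1 := zpow_mul_zpow 1 (-1)
  have e : l.ell h1 = (zpow 1 - const ζ h1.le) * (zpow (-1) * l.cofactor h1) := by
    rw [ell_eq]; linear_combination -l.cofactor h1 * hz
  have hu : IsUnit (taylor h0 h1 (l.cofactor h1)) :=
    PowerSeries.isUnit_iff_constantCoeff.2 (isUnit_iff_ne_zero.2 (l.eval_cofactor_ne_zero h0 h1))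
  obtain ⟨u, hu'⟩ := ((isUnit_zpow (-1)).map (taylor h0 h1)).mul hu
  exact ⟨u, by rw [e, map_mul, taylor_zpow_one_sub, hu', map_mul]⟩

/-- The elements of `F((z)) ℓ ^ n` are the `h` with `σ h = z ^ n h` that vanish at `ζ` to
order `n`. -/
lemma exists_eq_ell_pow_mul (n : ℕ) {h : BRig C} (hh : sigma F h = zpow n * h)
    {g : PowerSeries C} (hg : taylor h0 h1 h = taylor h0 h1 (l.ell h1) ^ n * g) :
    ∃ a : LaurentSeries F, h = l.ell h1 ^ n * ofLaurent F C a := by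
  induction n generalizing h with
  | zero =>
    obtain ⟨a, ha⟩ := exists_ofLaurent_eq F (h := h) (hh.trans (BRig.one_mul h))
    exact ⟨a, by rw [ha, pow_zero, one_mul]⟩
  | succ n ih =>
    have hev : eval h0 h1 h = 0 := by
      have h2 := l.eval_ell h0 h1
      rw [eval, RingHom.comp_apply] at h2 ⊢
      rw [hg, map_mul, map_pow, h2, zero_pow n.succ_ne_zero, zero_mul]
    rw [Nat.cast_succ] at hh
    obtain ⟨f, rfl, hf⟩ := l.exists_eq_ell_mul h0 h1 hh hev
    rw [map_mul, pow_succ', mul_assoc] at hg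
    obtain ⟨a, rfl⟩ := ih hf (mul_left_cancel₀ (l.taylor_ell_ne_zero h0 h1) hg)
    exact ⟨a, by ring⟩

/-- The invariants are the quotients `h / ℓ ^ n` with `σ h = z ^ n h`. -/
lemma exists_mul_ell_pow_eq (f : l.invariants h1) : ∃ (n : ℕ) (h : BRig C),
    sigma F h = zpow n * h ∧
      f.1 * algebraMap (BRig C) (l.BRigLoc h1) (l.ell h1) ^ n = algebraMap _ _ h := by
  obtain ⟨n, a, ha⟩ := IsLocalization.Away.surj (l.ell h1) f.1
  have hf : l.sigmaLoc h1 f.1 = f.1 := f.2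
  have h2 := congrArg (l.sigmaLoc h1) ha
  rw [map_mul, map_pow, sigmaLoc_algebraMap, sigmaLoc_algebraMap, hf, sigma_ell, map_mul,
    mul_pow, mul_left_comm, ha, ← map_pow, ← map_mul] at h2
  -- An equality in the localization holds in the ring only after multiplication by some `ℓ ^ k`;
  -- enlarging the fraction by `ℓ ^ k` absorbs this.
  obtain ⟨⟨_, k, rfl⟩, hc⟩ := IsLocalization.exists_of_eq (M := Submonoid.powers (l.ell h1)) h2
  refine ⟨n + k, l.ell h1 ^ k * a, ?_, ?_⟩
  · rw [map_mul, map_pow, sigma_ell, ← zpow_one_pow]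
    linear_combination -(zpow 1 ^ k) * hc
  · rw [pow_add, ← mul_assoc, ha, map_mul, map_pow, mul_comm]

lemma mem_invariants_of_mul_ell_pow_eq {f : l.BRigLoc h1} {n : ℕ} {h : BRig C}
    (hh : sigma F h = zpow n * h)
    (hf : f * algebraMap (BRig C) (l.BRigLoc h1) (l.ell h1) ^ n = algebraMap _ _ h) :
    f ∈ l.invariants h1 := by
  change l.sigmaLoc h1 f = f
  have h2 := congrArg (l.sigmaLoc h1) hf
  rw [map_mul, map_pow, sigmaLoc_algebraMap, sigmaLoc_algebraMap, hh, sigma_ell, map_mul, map_mul,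
    ← hf, mul_pow, ← map_pow, zpow_one_pow] at h2
  have hu : IsUnit (algebraMap (BRig C) (l.BRigLoc h1) (zpow n) *
      algebraMap (BRig C) (l.BRigLoc h1) (l.ell h1) ^ n) :=
    ((isUnit_zpow _).map _).mul
      ((IsLocalization.Away.algebraMap_isUnit (S := l.BRigLoc h1) (l.ell h1)).pow n)
  refine hu.mul_right_cancel (h2.trans (by ring))

lemma diag_injective : Function.Injective (l.diag h0 h1) := by
  intro a b hab
  exact ((taylor h0 h1).comp (ofLaurent F C)).injective (congrArg Prod.snd hab)

/-- This is the `F((z))`-linearity of the second map, with scalars acting on the source through the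
diagonal. -/
lemma diff_diag_mul (a : LaurentSeries F) (x : l.invariants h1 × PowerSeries C) :
    l.diff h0 h1 (l.diag h0 h1 a * x) = scalar h0 h1 a * l.diff h0 h1 x := by
  have e : l.taylorLoc h0 h1 (l.toInvariants h1 a) = scalar h0 h1 a :=
    l.taylorLoc_algebraMap h0 h1 _
  have e2 : HahnSeries.ofPowerSeries ℤ C (taylor h0 h1 (ofLaurent F C a)) = scalar h0 h1 a := rfl
  rw [diff_apply, diff_apply, mul_sub, ← e]
  change l.taylorLoc h0 h1 (l.toInvariants h1 a * x.1) -
    HahnSeries.ofPowerSeries ℤ C (taylor h0 h1 (ofLaurent F C a) * x.2) = _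
  rw [map_mul, map_mul, e2, e]

lemma diff_diag (a : LaurentSeries F) : l.diff h0 h1 (l.diag h0 h1 a) = 0 := by
  have h2 := l.diff_diag_mul h0 h1 a 1
  rw [mul_one] at h2
  rw [h2, diff_apply]
  simp

/-- If the expansion of `f = h / ℓ ^ n` is a power series, then that of `h` is divisible by the
`n`-th power of that of `ℓ`, so repeated division gives `h = ℓ ^ n a` with `a` in `F((z))`. -/
lemma exact_diag_diff : Function.Exact (l.diag h0 h1) (l.diff h0 h1) := by
  rintro ⟨f, g⟩
  constructor
  · intro hfg
    rw [diff_apply, sub_eq_zero] at hfg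
    dsimp only at hfg
    obtain ⟨n, h, hh, hf⟩ := l.exists_mul_ell_pow_eq h1 f
    have h2 := congrArg (l.taylorLoc h0 h1) hf
    rw [map_mul, map_pow, taylorLoc_algebraMap, taylorLoc_algebraMap, hfg, ← map_pow,
      ← map_mul] at h2
    have h3 := HahnSeries.ofPowerSeries_injective h2
    obtain ⟨a, rfl⟩ := l.exists_eq_ell_pow_mul h0 h1 n hh (h3.symm.trans (mul_comm _ _))
    have hu := (IsLocalization.Away.algebraMap_isUnit (S := l.BRigLoc h1) (l.ell h1)).pow n
    have hfa : f.1 = algebraMap _ _ (ofLaurent F C a) := by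
      rw [map_mul, map_pow, mul_comm f.1] at hf
      exact hu.mul_left_cancel hf
    refine ⟨a, Prod.ext (Subtype.ext hfa.symm) (HahnSeries.ofPowerSeries_injective (Γ := ℤ) ?_)⟩
    rw [← hfg, hfa, taylorLoc_algebraMap]
    rfl
  · rintro ⟨a, ha⟩
    rw [← ha, diff_diag]

variable [IsAlgClosed C]

/-- Induction on the pole order, measured by powers of `ℓ`. Choosing `h` with the same value at `ζ`
as `v`, the invariant `h / ℓ ^ (n + 1)` cancels the leading polar term of `u`. As `ℓ` has only a
simple zero, the new numerator is divisible by its expansion. -/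
lemma mem_range_diff_of_ell_pow_mul (n : ℕ) (u : LaurentSeries C) (v : PowerSeries C)
    (hu : HahnSeries.ofPowerSeries ℤ C (taylor h0 h1 (l.ell h1)) ^ n * u =
      HahnSeries.ofPowerSeries ℤ C v) : u ∈ (l.diff h0 h1).range := by
  set L := HahnSeries.ofPowerSeries ℤ C (taylor h0 h1 (l.ell h1)) with hL
  have hL0 : L ≠ 0 := (map_ne_zero_iff _ HahnSeries.ofPowerSeries_injective).2
    (l.taylor_ell_ne_zero h0 h1)
  induction n generalizing u v with
  | zero =>
    refine ⟨(0, -v), ?_⟩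
    rw [pow_zero, one_mul] at hu
    rw [diff_apply, hu]
    simp
  | succ n ih =>
    obtain ⟨h, hh, hhv⟩ := exists_eval_eq_pow F h0 h1 n (PowerSeries.constantCoeff v)
    rw [zpow_one_pow] at hh
    obtain ⟨b, hb⟩ := (IsLocalization.Away.algebraMap_isUnit (S := l.BRigLoc h1) (l.ell h1))
    have hf : algebraMap _ _ h * (↑(b⁻¹ ^ (n + 1)) : l.BRigLoc h1) *
        algebraMap (BRig C) (l.BRigLoc h1) (l.ell h1) ^ (n + 1) = algebraMap _ _ h := by
      rw [← hb, mul_assoc, ← Units.val_pow_eq_pow_val, ← Units.val_mul, inv_pow, inv_mul_cancel,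
        Units.val_one, mul_one]
    have hmem := l.mem_invariants_of_mul_ell_pow_eq h1 hh hf
    set f := algebraMap _ _ h * (↑(b⁻¹ ^ (n + 1)) : l.BRigLoc h1)
    have hLf := congrArg (l.taylorLoc h0 h1) hf
    rw [map_mul, map_pow, taylorLoc_algebraMap, taylorLoc_algebraMap, ← hL] at hLf
    have hX : PowerSeries.X ∣ v - taylor h0 h1 h := by
      rw [PowerSeries.X_dvd_iff, map_sub, ← hhv]
      exact sub_self _
    obtain ⟨w, hw⟩ := (l.taylor_ell_associated h0 h1).symm.dvd.trans hX
    have h2 : L ^ n * (u - l.taylorLoc h0 h1 f) = HahnSeries.ofPowerSeries ℤ C w := by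
      apply mul_left_cancel₀ hL0
      rw [hL, ← map_mul, ← hw, map_sub, ← hL, ← hu, ← hLf]
      ring
    have h3 : l.taylorLoc h0 h1 f ∈ (l.diff h0 h1).range :=
      ⟨(⟨f, hmem⟩, 0), by rw [diff_apply]; simp⟩
    have h4 := add_mem (ih _ w h2) h3
    rwa [sub_add_cancel] at h4

lemma diff_surjective : Function.Surjective (l.diff h0 h1) := by
  intro u
  obtain ⟨w, hw⟩ := l.taylor_ell_associated h0 h1
  obtain ⟨n, v, hv⟩ : ∃ (n : ℕ) (v : PowerSeries C),
      HahnSeries.ofPowerSeries ℤ C PowerSeries.X ^ n * u = HahnSeries.ofPowerSeries ℤ C v := by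
    have e := LaurentSeries.single_order_mul_powerSeriesPart u
    generalize u.powerSeriesPart = p, u.order = d at e
    -- With `n = max (-d) 0`, where `d` is the order of `u`, the exponent `d + n` is non-negative.
    refine ⟨(-d).toNat, PowerSeries.X ^ (d + (-d).toNat).toNat * p, ?_⟩
    rw [← e, map_mul, map_pow, HahnSeries.ofPowerSeries_X, HahnSeries.single_pow,
      HahnSeries.single_pow, one_pow, one_pow, ← mul_assoc, HahnSeries.single_mul_single, one_mul]
    congr 2
    simp only [nsmul_eq_mul, mul_one]
    rw [Int.toNat_of_nonneg (by omega : 0 ≤ d + ((-d).toNat : ℤ)), add_comm]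
  refine l.mem_range_diff_of_ell_pow_mul h0 h1 n u (w ^ n * v) ?_
  rw [← hw, map_mul, mul_pow, map_mul, map_pow, ← hv]
  ring

end DivisionTower
end Exactness

end FundSeq

end

theorem mainTheorem6 {F K : Type*} [Field F] [Finite F] [NontriviallyNormedField K]
    [IsUltrametricDist K] [CompleteSpace K] [Algebra F K]
    (ζ : K) (hζ0 : ζ ≠ 0) (hζ1 : ‖ζ‖ < 1) :
    (∀ l : FundSeq.DivisionTower F (FundSeq.Kbar.ofBase K ζ),
      Function.Injective (l.diag (FundSeq.Kbar.ofBase_ne_zero hζ0)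
        (FundSeq.Kbar.norm_ofBase_lt hζ1)) ∧
      Function.Exact
        (l.diag (FundSeq.Kbar.ofBase_ne_zero hζ0) (FundSeq.Kbar.norm_ofBase_lt hζ1))
        (l.diff (FundSeq.Kbar.ofBase_ne_zero hζ0) (FundSeq.Kbar.norm_ofBase_lt hζ1)) ∧
      Function.Surjective
        (l.diff (FundSeq.Kbar.ofBase_ne_zero hζ0) (FundSeq.Kbar.norm_ofBase_lt hζ1)) ∧
      ∀ (a : LaurentSeries F)
        (x : l.invariants (FundSeq.Kbar.norm_ofBase_lt hζ1) × PowerSeries (FundSeq.Kbar K)),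
        l.diff (FundSeq.Kbar.ofBase_ne_zero hζ0) (FundSeq.Kbar.norm_ofBase_lt hζ1)
          (l.diag (FundSeq.Kbar.ofBase_ne_zero hζ0) (FundSeq.Kbar.norm_ofBase_lt hζ1) a * x) =
        FundSeq.BRig.scalar (F := F) (FundSeq.Kbar.ofBase_ne_zero hζ0)
            (FundSeq.Kbar.norm_ofBase_lt hζ1) a *
          l.diff (FundSeq.Kbar.ofBase_ne_zero hζ0) (FundSeq.Kbar.norm_ofBase_lt hζ1) x) ∧
    ∀ c : FundSeq.Kbar K, ∃ f : FundSeq.BRig (FundSeq.Kbar K),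
      f = FundSeq.BRig.zpow (-1) * FundSeq.BRig.sigma F f ∧
      HasSum (fun i : ℤ => f.coeff i * FundSeq.Kbar.ofBase K ζ ^ i) c := by
  have h0 := FundSeq.Kbar.ofBase_ne_zero hζ0
  have h1 := FundSeq.Kbar.norm_ofBase_lt hζ1
  refine ⟨fun l => ⟨l.diag_injective h0 h1, l.exact_diag_diff h0 h1, l.diff_surjective h0 h1,
    l.diff_diag_mul h0 h1⟩, fun c => ?_⟩
  obtain ⟨f, hf, hfc⟩ := FundSeq.BRig.exists_eval_eq F h0 h1 c
  refine ⟨f, ?_, hfc ▸ FundSeq.BRig.hasSum_eval h0 h1 f⟩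
  rw [hf, ← mul_assoc, FundSeq.BRig.zpow_mul_zpow]
  exact (FundSeq.BRig.one_mul f).symm
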